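/- Work on the Riemann sphere $\widehat{\mathbb C}=\mathbb C\cup\{\infty\}$. For $\alpha\subseteq\widehat{\mathbb C}$ let $\mathcal A_\alpha$ be its stabilizer, the group of all Möbius transformations $f$ with $f(\alpha)=\alpha$. For an integer $n\ge 1$ put $$V=\{0,\infty\},\qquad A_n=\{e^{\frac{k}{n}2\pi i}\mid k\in\mathbb Z\},\qquad B_n=\{e^{\frac{2k+1}{2n}2\pi i}\mid k\in\mathbb Z\},$$ $$C_n(z)=\{ze^{\frac{k}{n}2\pi i}\mid k\in\mathbb Z\}\cup\{z^{-1}e^{\frac{k}{n}2\pi i}\mid k\in\mathbb Z\},$$ $$\mathcal O_n=\{V,A_n,B_n\}\cup\{C_n(z)\mid z\in\mathbb C^*\setminus\{e^{\frac{l}{2n}2\pi i}\mid l\in\mathbb Z\}\}.$$ Let $\phi(z)=\frac{z-1}{z+1}$ and $\psi(z)=\frac{z+i}{iz+1}$, and write $\phi(\mathcal O)=\{\phi(s)\mid s\in\mathcal O\}$, and similarly $\psi(\mathcal O)$. We say that $\alpha$ is in the icosahedral (respectively octahedral) case if it is a union of orbits of some group of Möbius transformations isomorphic to $A_5$ (respectively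 $S_4$), and in the tetrahedral case if it is a union of orbits of some group of Möbius transformations isomorphic to $A_4$ and is in neither of the two previous cases. **Theorem.** Let $n\ge 2$ and let $\alpha\subseteq\widehat{\mathbb C}$ be a finite set with $|\alpha|\ge 3$. Then $$\mathcal A_\alpha=\langle z\mapsto e^{\frac{1}{n}2\pi i}z,\ z\mapsto \tfrac1z\rangle$$ if and only if all of the following hold: 1. $\alpha$ is a union of certain elements of $\mathcal O_n$; 2. for every integer $p\ge 2$, $\alpha$ is not a union of certain elements of $\mathcal O_{pn}$; 3. if $n=2$, then for every integer $p\ge 2$, $\alpha$ is not a union of certain elements of $\phi(\mathcal O_{2p})$; 4. if $n=2$, then for every integer $p\ge 2$, $\alpha$ is not a union of certain elements of $\psi(\mathcal O_{2p})$; 5. $\alpha$ is not in the icosahedral, octahedral or tetrahedral case. -/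

import Mathlib

open scoped Pointwise

noncomputable section

namespace MoebiusStab

/-- The extended complex plane, i.e. the Riemann sphere. -/
abbrev Sphere : Type := OnePoint ℂ

/-- The group of all Moebius transformations `z ↦ (a z + b) / (c z + d)`, `a d - b c ≠ 0`,
as a group of permutations of the extended complex plane. -/
def moebiusGroup : Subgroup (Equiv.Perm Sphere) :=
  (MulAction.toPermHom (GL (Fin 2) ℂ) Sphere).range

/-- The Moebius transformation `z ↦ (a z + b) / (c z + d)`. -/
def moebius (a b c d : ℂ) (h : a * d - b * c ≠ 0) : moebiusGroup :=
  (MulAction.toPermHom (GL (Fin 2) ℂ) Sphere).rangeRestrict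
    (Matrix.GeneralLinearGroup.mkOfDetNeZero !![a, b; c, d]
      (by rw [Matrix.det_fin_two_of]; exact h))

/-- The defining formula of `moebius` at finite points. -/
theorem moebius_smul_coe (a b c d : ℂ) (h : a * d - b * c ≠ 0) (z : ℂ) :
    moebius a b c d h • (z : Sphere)
      = if c * z + d = 0 then OnePoint.infty else (((a * z + b) / (c * z + d) : ℂ) : Sphere) := by
  change (Matrix.GeneralLinearGroup.mkOfDetNeZero !![a, b; c, d] _ : GL (Fin 2) ℂ) •
    (z : OnePoint ℂ) = _
  rw [OnePoint.smul_some_eq_ite]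
  simp [Matrix.GeneralLinearGroup.mkOfDetNeZero]

/-- The defining formula of `moebius` at infinity. -/
theorem moebius_smul_infty (a b c d : ℂ) (h : a * d - b * c ≠ 0) :
    moebius a b c d h • (OnePoint.infty : Sphere)
      = if c = 0 then OnePoint.infty else ((a / c : ℂ) : Sphere) := by
  change (Matrix.GeneralLinearGroup.mkOfDetNeZero !![a, b; c, d] _ : GL (Fin 2) ℂ) •
    (OnePoint.infty : OnePoint ℂ) = _
  rw [OnePoint.smul_infty_eq_ite]
  simp [Matrix.GeneralLinearGroup.mkOfDetNeZero]

/-- The stabilizer of `α`: all Moebius transformations `f` with `f(α) = α`. -/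
def stab (α : Set Sphere) : Subgroup moebiusGroup :=
  MulAction.stabilizer moebiusGroup α

/-- `turn t = e^{t · 2πi}`. -/
def turn (t : ℂ) : ℂ := Complex.exp (t * (2 * Real.pi * Complex.I))

/-- The rotation `z ↦ e^{2πi/n} z`. -/
def rotation (n : ℕ) : moebiusGroup :=
  moebius (turn (1 / n)) 0 0 1 (by simp [turn, Complex.exp_ne_zero])

/-- The inversion `z ↦ 1/z`. -/
def inversion : moebiusGroup := moebius 0 1 1 0 (by norm_num)

/-- The dihedral group `⟨z ↦ e^{2πi/n} z, z ↦ 1/z⟩`. -/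
def dihedral (n : ℕ) : Subgroup moebiusGroup :=
  Subgroup.closure {rotation n, inversion}

/-- `φ(z) = (z - 1) / (z + 1)`. -/
def phi : moebiusGroup := moebius 1 (-1) 1 1 (by norm_num)

/-- `ψ(z) = (z + i) / (i z + 1)`. -/
def psi : moebiusGroup := moebius 1 Complex.I Complex.I 1 (by norm_num)

/-- `V = {0, ∞}`. -/
def orbV : Set Sphere := {((0 : ℂ) : Sphere), OnePoint.infty}

/-- `A_n = {e^{(k/n) 2πi} | k ∈ ℤ}`. -/
def orbA (n : ℕ) : Set Sphere := {x | ∃ k : ℤ, x = ((turn (k / n) : ℂ) : Sphere)}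

/-- `B_n = {e^{((2k+1)/(2n)) 2πi} | k ∈ ℤ}`. -/
def orbB (n : ℕ) : Set Sphere :=
  {x | ∃ k : ℤ, x = ((turn ((2 * k + 1) / (2 * n)) : ℂ) : Sphere)}

/-- `C_n(z) = {z e^{(k/n) 2πi} | k ∈ ℤ} ∪ {z⁻¹ e^{(k/n) 2πi} | k ∈ ℤ}`. -/
def orbC (n : ℕ) (z : ℂ) : Set Sphere :=
  {x | ∃ k : ℤ, x = ((z * turn (k / n) : ℂ) : Sphere)} ∪
    {x | ∃ k : ℤ, x = ((z⁻¹ * turn (k / n) : ℂ) : Sphere)}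

/-- The family `{V, A_n, B_n} ∪ {C_n(z) | z ∈ ℂ* \ {e^{(l/(2n)) 2πi} | l ∈ ℤ}}`. -/
def dihedralOrbits (n : ℕ) : Set (Set Sphere) :=
  {orbV, orbA n, orbB n} ∪
    {s | ∃ z : ℂ, z ≠ 0 ∧ (∀ l : ℤ, z ≠ turn (l / (2 * n))) ∧ s = orbC n z}

/-- `α` is a union of certain elements of the family `F`. -/
def IsUnionOf (F : Set (Set Sphere)) (α : Set Sphere) : Prop :=
  ∃ T : Set (Set Sphere), T ⊆ F ∧ α = ⋃₀ T

/-- The image family `{f(s) | s ∈ F}`. -/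
def imageFamily (f : moebiusGroup) (F : Set (Set Sphere)) : Set (Set Sphere) :=
  (fun s => f • s) '' F

/-- `α` is a union of orbits of some group of Moebius transformations isomorphic to `K`. -/
def IsOrbitUnionOfType (K : Type) [Group K] (α : Set Sphere) : Prop :=
  ∃ H : Subgroup moebiusGroup, Nonempty (H ≃* K) ∧
    IsUnionOf (Set.range fun x : Sphere => MulAction.orbit H x) α

/-- The icosahedral case: `α` is a union of orbits of an icosahedral group `≃ A₅`. -/
def IcosahedralCase (α : Set Sphere) : Prop := IsOrbitUnionOfType (alternatingGroup (Fin 5)) α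

/-- The octahedral case: `α` is a union of orbits of an octahedral group `≃ S₄`. -/
def OctahedralCase (α : Set Sphere) : Prop := IsOrbitUnionOfType (Equiv.Perm (Fin 4)) α

/-- The tetrahedral case: `α` is a union of orbits of a tetrahedral group `≃ A₄` (and is not in
one of the two larger cases). -/
def TetrahedralCase (α : Set Sphere) : Prop :=
  IsOrbitUnionOfType (alternatingGroup (Fin 4)) α ∧ ¬ IcosahedralCase α ∧ ¬ OctahedralCase α

end MoebiusStab

end

/-! A set is a union of elements of O_n exactly when `dihedral n` stabilizes it, and the other
families translate likewise (`isUnionOf_dihedralOrbits_iff`, `isUnionOf_imageFamily_iff`,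
`isUnionOf_orbits_iff`). So the theorem is about which finite groups of Möbius transformations
contain D_n.

If the stabilizer is D_n, conditions 2 to 4 hold because D_n has no rotation of order pn about {0,
∞}, and elements of the Klein four-group D_2 have trivial squares. Condition 5 holds because squares
commute in D_n but not in A₄, S₄ or A₅.

Conversely, let G be the stabilizer, and suppose that it contains D_n properly. Since |α| ≥ 3, G is
finite, and its nontrivial elements have exactly two fixed points. Burnside's count on the points
with nontrivial stabilizer leaves an orbit of two points, or the orders 12, 24, 60. In the last
three cases G contains a copy of A₄ (`exists_pair_or_alternatingGroup`). This suffices for condition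
5: the tetrahedral case merely excludes the other two, so A₅ itself need not be recognized.

An invariant pair must be {0, ∞}, or n = 2 and the pair is {1, -1} = φ{0, ∞} or {i, -i} = ψ{0, ∞}
(`invariant_pair_cases`). A finite group preserving {0, ∞} and containing D_n is some D_m with n ∣ m
(`exists_eq_dihedral`), which contradicts condition 2, or, after conjugation by φ or ψ, condition 3
or 4. -/

namespace MoebiusStab

open MulAction

/-! ### Finite groups whose nontrivial elements fix exactly two points: Burnside's count -/

section TwoFixedPoints

variable {G S : Type*} [Group G] [MulAction G S]

/-- The points with nontrivial stabilizer. -/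
def nonfree (G S : Type*) [Group G] [MulAction G S] : SubMulAction G S where
  carrier := {x | ∃ g : G, g ≠ 1 ∧ g • x = x}
  smul_mem' := by
    rintro k x ⟨g, hg, hx⟩
    refine ⟨k * g * k⁻¹, ?_, ?_⟩
    · intro h
      exact hg (conj_eq_one_iff.mp h)
    · simp [mul_smul, hx]

theorem finite_nonfree [Finite G] (h2 : ∀ g : G, g ≠ 1 → (fixedBy S g).ncard = 2) :
    Finite (nonfree G S) := by
  have h : (nonfree G S : Set S) = ⋃ g : {g : G // g ≠ 1}, fixedBy S g.1 := by
    ext x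
    simp only [Set.mem_iUnion, mem_fixedBy, Subtype.exists, exists_prop]
    rfl
  have : (nonfree G S : Set S).Finite := by
    rw [h]
    refine Set.finite_iUnion fun g => Set.finite_of_ncard_ne_zero ?_
    rw [h2 _ g.2]; norm_num
  exact this

theorem card_orbit_nonfree (x : nonfree G S) :
    Nat.card (orbit G x) = Nat.card (orbit G (x : S)) := by
  rw [← SubMulAction.val_image_orbit x]
  exact (Nat.card_image_of_injective Subtype.val_injective _).symm

theorem card_orbit_mul_card_stabilizer' [Finite G] (x : S) :
    Nat.card (orbit G x) * Nat.card (stabilizer G x) = Nat.card G := by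
  rw [← Nat.card_prod, Nat.card_congr (orbitProdStabilizerEquivGroup G x)]

/-- Burnside's count: the orbits of points with nontrivial stabilizer. -/
theorem burnside_nonfree [Finite G] (h2 : ∀ g : G, g ≠ 1 → (fixedBy S g).ncard = 2)
    [Fintype (orbitRel.Quotient G (nonfree G S))] :
    ∑ ω : orbitRel.Quotient G (nonfree G S), Nat.card (orbit G ω.out) + 2 * Nat.card G =
      Fintype.card (orbitRel.Quotient G (nonfree G S)) * Nat.card G + 2 := by
  classical
  have := Fintype.ofFinite G
  have := finite_nonfree h2
  have := Fintype.ofFinite (nonfree G S)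
  have hb := sum_card_fixedBy_eq_card_orbits_mul_card_group (G := G) (X := nonfree G S)
  have h1 : Fintype.card (nonfree G S) =
      ∑ ω : orbitRel.Quotient G (nonfree G S), Nat.card (orbit G ω.out) := by
    rw [← Nat.card_eq_fintype_card, Nat.card_congr (selfEquivSigmaOrbits G (nonfree G S)),
      Nat.card_sigma]
  -- Restricting to `nonfree` loses no fixed point of a nontrivial element. The identity alone fixes
  -- all of `nonfree`.
  have h3 : ∀ g : G, g ≠ 1 → Fintype.card (fixedBy (nonfree G S) g) = 2 := by
    intro g hg
    rw [← h2 g hg, ← Nat.card_eq_fintype_card, ← Nat.card_coe_set_eq]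
    refine Nat.card_congr ⟨fun x => ⟨x.1.1, congrArg Subtype.val x.2⟩,
      fun x => ⟨⟨x.1, g, hg, x.2⟩, Subtype.ext x.2⟩, fun x => rfl, fun x => rfl⟩
  rw [← Finset.add_sum_erase _ _ (Finset.mem_univ (1 : G)),
    Finset.sum_congr rfl (fun g hg => h3 g (Finset.ne_of_mem_erase hg))] at hb
  have h4 : Fintype.card (fixedBy (nonfree G S) (1 : G)) = Fintype.card (nonfree G S) := by
    rw [← Nat.card_eq_fintype_card, ← Nat.card_eq_fintype_card]
    exact Nat.card_congr ⟨fun x => x.1, fun x => ⟨x, one_smul _ x⟩, fun x => rfl, fun x => rfl⟩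
  rw [h4, h1, Finset.sum_const, Finset.card_erase_of_mem (Finset.mem_univ _), Finset.card_univ,
    ← Nat.card_eq_fintype_card (α := G), smul_eq_mul] at hb
  have : 0 < Nat.card G := Nat.card_pos
  rw [← hb]
  omega

/-- For r orbits and N = |G|, Burnside gives total size (r - 2)N + 2. Every orbit has at least 2
points, as nothing is fixed by all of G, and at most N/2, as stabilizers are nontrivial. These
bounds force r = 3. -/
theorem exists_three_orbits [Finite G] [Nontrivial G]
    (h2 : ∀ g : G, g ≠ 1 → (fixedBy S g).ncard = 2) (hfix : ∀ x : S, ∃ g : G, g • x ≠ x) :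
    ∃ x y z : S,
      (∀ w ∈ nonfree G S, w ∈ orbit G x ∨ w ∈ orbit G y ∨ w ∈ orbit G z) ∧
      x ∈ nonfree G S ∧ y ∈ nonfree G S ∧ z ∈ nonfree G S ∧
      Nat.card (orbit G x) + Nat.card (orbit G y) + Nat.card (orbit G z) = Nat.card G + 2 := by
  classical
  have := finite_nonfree h2
  have := Fintype.ofFinite (nonfree G S)
  let Ω := orbitRel.Quotient G (nonfree G S)
  have := Fintype.ofFinite Ω
  have hb : ∑ ω : Ω, Nat.card (orbit G ω.out) + 2 * Nat.card G =
      Fintype.card Ω * Nat.card G + 2 := burnside_nonfree h2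
  have hN : 1 < Nat.card G := Finite.one_lt_card
  have hlow : ∀ ω : Ω, 2 ≤ Nat.card (orbit G ω.out) := by
    intro ω
    rw [card_orbit_nonfree]
    obtain ⟨g, hg⟩ := hfix ω.out
    have : Finite (orbit G (ω.out : S)) := Set.finite_range _
    have : Nontrivial (orbit G (ω.out : S)) :=
      ⟨⟨⟨_, mem_orbit _ g⟩, ⟨_, mem_orbit_self _⟩, fun h => hg (congrArg Subtype.val h)⟩⟩
    exact Finite.one_lt_card
  have hup : ∀ ω : Ω, 2 * Nat.card (orbit G ω.out) ≤ Nat.card G := by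
    intro ω
    rw [card_orbit_nonfree, ← card_orbit_mul_card_stabilizer' (G := G) (ω.out : S), mul_comm]
    refine Nat.mul_le_mul_left _ ?_
    obtain ⟨g, hg, hx⟩ := ω.out.2
    have : Nontrivial (stabilizer G (ω.out : S)) :=
      ⟨⟨⟨g, hx⟩, 1, fun h => hg (congrArg Subtype.val h)⟩⟩
    exact Finite.one_lt_card
  have h1 : Fintype.card Ω * 2 ≤ ∑ ω : Ω, Nat.card (orbit G ω.out) := by
    rw [← smul_eq_mul]
    exact Finset.card_nsmul_le_sum _ _ _ fun ω _ => hlow ω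
  have h3 : 2 * ∑ ω : Ω, Nat.card (orbit G ω.out) ≤ Fintype.card Ω * Nat.card G := by
    rw [Finset.mul_sum, ← smul_eq_mul]
    exact Finset.sum_le_card_nsmul _ _ _ fun ω _ => hup ω
  have hr : Fintype.card Ω = 3 := by
    generalize Fintype.card Ω = r at *
    have h4 : r < 4 := by
      by_contra! h
      nlinarith
    interval_cases r <;> omega
  obtain ⟨a, b, c, hab, hac, hbc, hu⟩ := Finset.card_eq_three.mp (Finset.card_univ.trans hr)
  refine ⟨a.out, b.out, c.out, ?_, a.out.2, b.out.2, c.out.2, ?_⟩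
  · intro w hw
    have key : ∀ ω : Ω, (Quotient.mk'' (⟨w, hw⟩ : nonfree G S) : Ω) = ω →
        w ∈ orbit G (ω.out : S) := by
      rintro ω rfl
      have : (⟨w, hw⟩ : nonfree G S) ∈ orbit G (Quotient.out (Quotient.mk'' (⟨w, hw⟩ : nonfree G S) : Ω)) := by
        have := Quotient.exact (Quotient.out_eq (Quotient.mk'' (⟨w, hw⟩ : nonfree G S) : Ω))
        exact orbitRel_apply.mp ((orbitRel G (nonfree G S)).symm this)
      obtain ⟨g, hg⟩ := this
      exact ⟨g, congrArg Subtype.val hg⟩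
    have hm : (Quotient.mk'' (⟨w, hw⟩ : nonfree G S) : Ω) ∈ ({a, b, c} : Finset Ω) :=
      hu ▸ Finset.mem_univ _
    simp only [Finset.mem_insert, Finset.mem_singleton] at hm
    rcases hm with h | h | h
    · exact Or.inl (key _ h)
    · exact Or.inr (Or.inl (key _ h))
    · exact Or.inr (Or.inr (key _ h))
  · rw [hr, hu, Finset.sum_insert (by simp [hab, hac]), Finset.sum_pair hbc] at hb
    simp only [card_orbit_nonfree] at hb
    omega

/-! ### Recognizing A₄ and S₄ -/

theorem eq_one_of_three_fixed (h2 : ∀ g : G, g ≠ 1 → (fixedBy S g).ncard = 2) {g : G} {s : Set S}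
    (hs : 3 ≤ s.ncard) (hfix : ∀ x ∈ s, g • x = x) : g = 1 := by
  by_contra hg
  have h := h2 g hg
  have : s.ncard ≤ (fixedBy S g).ncard :=
    Set.ncard_le_ncard hfix (Set.finite_of_ncard_ne_zero (by omega))
  omega

theorem ncard_fixedBy_subgroup (h2 : ∀ g : G, g ≠ 1 → (fixedBy S g).ncard = 2) (H : Subgroup G)
    (g : H) (hg : g ≠ 1) : (fixedBy S g).ncard = 2 :=
  h2 g fun h => hg (Subtype.ext h)

/-- The action on the four-point orbit is faithful, since fixing three points forces the identity.
Its image has index 2 in S₄, and A₄ is the only such subgroup. -/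
theorem nonempty_mulEquiv_alternatingGroup_four [Finite G]
    (h2 : ∀ g : G, g ≠ 1 → (fixedBy S g).ncard = 2)
    (hG : Nat.card G = 12) (x : S) (hx : Nat.card (orbit G x) = 4) :
    Nonempty (G ≃* alternatingGroup (Fin 4)) := by
  have : Finite (orbit G x) := Nat.finite_of_card_ne_zero (by omega)
  let e : orbit G x ≃ Fin 4 := Finite.equivFinOfCardEq hx
  let f : G →* Equiv.Perm (Fin 4) := e.permCongrHom.toMonoidHom.comp (toPermHom G (orbit G x))
  have hf : Function.Injective f := by
    refine e.permCongrHom.injective.comp ((injective_iff_map_eq_one _).2 fun g hg => ?_)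
    refine eq_one_of_three_fixed (S := S) h2 (s := orbit G x)
      (by rw [← Nat.card_coe_set_eq]; omega) fun y hy => ?_
    exact congrArg Subtype.val (DFunLike.congr_fun hg ⟨y, hy⟩)
  have hr : f.range = alternatingGroup (Fin 4) := by
    refine Equiv.Perm.eq_alternatingGroup_of_index_eq_two ?_
    have h1 := f.range.card_mul_index
    have h3 : Nat.card f.range = 12 := by
      rw [← hG]
      exact (Nat.card_congr (MonoidHom.ofInjective hf).toEquiv).symm
    rw [h3, Nat.card_perm, Nat.card_fin] at h1
    have : Nat.factorial 4 = 24 := rfl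
    omega
  exact ⟨(MonoidHom.ofInjective hf).trans (MulEquiv.subgroupCongr hr)⟩

theorem stabilizer_eq_of_card_three (hs : ∀ x : S, 3 ∣ Nat.card (stabilizer G x) →
    Nat.card (stabilizer G x) = 3) {P : Subgroup G} (hP : Nat.card P = 3) {x : S}
    (hx : P ≤ stabilizer G x) : stabilizer G x = P := by
  have h3 : Nat.card (stabilizer G x) = 3 := hs x (hP ▸ Subgroup.card_dvd_of_le hx)
  have : Finite (stabilizer G x) := Nat.finite_of_card_ne_zero (by omega)
  exact (Subgroup.eq_of_le_of_card_ge hx (by omega)).symm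

/-- A generator of P has the same two fixed points as P. Their stabilizers contain P and have order
3, so each fixed point determines P. -/
theorem exists_fixed_pair (h2 : ∀ g : G, g ≠ 1 → (fixedBy S g).ncard = 2)
    (hs : ∀ x : S, 3 ∣ Nat.card (stabilizer G x) → Nat.card (stabilizer G x) = 3)
    {P : Subgroup G} (hP : Nat.card P = 3) :
    ∃ a b : S, a ≠ b ∧ stabilizer G a = P ∧ stabilizer G b = P ∧
      ∀ x, P ≤ stabilizer G x → x = a ∨ x = b := by
  have : Fact (Nat.Prime 3) := ⟨Nat.prime_three⟩
  have : Finite P := Nat.finite_of_card_ne_zero (by omega)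
  have : Nontrivial P := Finite.one_lt_card_iff_nontrivial.mp (by omega)
  obtain ⟨p, hp⟩ := exists_ne (1 : P)
  have hgen : Subgroup.zpowers p = ⊤ := zpowers_eq_top_of_prime_card hP hp
  have hle : ∀ x : S, P ≤ stabilizer G x ↔ p • x = x := by
    refine fun x => ⟨fun h => h p.2, fun h q hq => ?_⟩
    obtain ⟨k, hk⟩ := Subgroup.mem_zpowers_iff.mp (hgen ▸ Subgroup.mem_top (⟨q, hq⟩ : P))
    have : (⟨q, hq⟩ : P) ∈ stabilizer P x := hk ▸ Subgroup.zpow_mem _ (show p ∈ stabilizer P x from h) k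
    exact this
  obtain ⟨a, b, hab, h⟩ := Set.ncard_eq_two.mp (ncard_fixedBy_subgroup h2 P p hp)
  have ha : p • a = a := by
    have : a ∈ fixedBy S p := h ▸ Set.mem_insert _ _
    exact this
  have hb : p • b = b := by
    have : b ∈ fixedBy S p := h ▸ Set.mem_insert_of_mem _ rfl
    exact this
  refine ⟨a, b, hab, stabilizer_eq_of_card_three hs hP ((hle a).2 ha),
    stabilizer_eq_of_card_three hs hP ((hle b).2 hb), fun x hx => ?_⟩
  have : x ∈ fixedBy S p := (hle x).1 hx
  rw [h] at this
  exact this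

/-- G acts on its Sylow 3-subgroups, each of which carries a pair of fixed points. There are four of
them, since a single one would give an invariant pair. A nontrivial element of the kernel would be
central, and its own fixed points would form an invariant pair. So the action is faithful, and 24 =
4! makes it onto. -/
theorem nonempty_mulEquiv_perm_four [Finite G] (h2 : ∀ g : G, g ≠ 1 → (fixedBy S g).ncard = 2)
    (hG : Nat.card G = 24)
    (hs : ∀ x : S, 3 ∣ Nat.card (stabilizer G x) → Nat.card (stabilizer G x) = 3)
    (hpair : ¬ ∃ x y : S, x ≠ y ∧ ∀ g : G, g • x = x ∨ g • x = y) :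
    Nonempty (G ≃* Equiv.Perm (Fin 4)) := by
  have : Fact (Nat.Prime 3) := ⟨Nat.prime_three⟩
  have hcard : ∀ P : Sylow 3 G, Nat.card P = 3 := by
    intro P
    rw [P.card_eq_multiplicity, hG, show 24 = 3 * 8 from rfl,
      Nat.factorization_mul (by norm_num) (by norm_num), Finsupp.add_apply,
      Nat.prime_three.factorization_self, Nat.factorization_eq_zero_of_not_dvd (by norm_num)]
    rfl
  choose a b hab ha hb hall using fun P : Sylow 3 G => exists_fixed_pair h2 hs (hcard P)
  have hinj : Function.Injective a := fun P Q h => by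
    refine Sylow.ext ?_
    rw [← ha P, ← ha Q, h]
  have hmove : ∀ (k : G) (P : Sylow 3 G), k • P = P → ∀ x, stabilizer G x = P →
      k • x = a P ∨ k • x = b P := by
    intro k P hk x hx
    refine hall P _ ?_
    rw [stabilizer_smul_eq_stabilizer_map_conj, hx]
    exact (congrArg Sylow.toSubgroup hk).ge
  have h4 : Nat.card (Sylow 3 G) = 4 := by
    obtain ⟨P⟩ : Nonempty (Sylow 3 G) := inferInstance
    have hd : Nat.card (Sylow 3 G) ∣ 8 := by
      have h := (P : Subgroup G).card_mul_index
      rw [hcard P, hG] at h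
      have : (P : Subgroup G).index = 8 := by omega
      exact this ▸ P.card_dvd_index
    have hm : Nat.card (Sylow 3 G) % 3 = 1 := card_sylow_modEq_one 3 G
    have h1 : Nat.card (Sylow 3 G) ≠ 1 := by
      intro h1
      have := (Nat.card_eq_one_iff_unique.mp h1).1
      exact hpair ⟨a P, b P, hab P, fun g => hmove g P (Subsingleton.elim _ _) _ (ha P)⟩
    have hle := Nat.le_of_dvd (by norm_num) hd
    generalize Nat.card (Sylow 3 G) = m at *
    interval_cases m <;> omega
  have hrange : 3 ≤ (Set.range a).ncard := by
    rw [← Nat.card_coe_set_eq, Nat.card_range_of_injective hinj]; omega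
  -- A kernel element preserves every pair, so its square fixes at least three points and is
  -- trivial. Fixing some `a P` would put it in P and give it a trivial cube as well.
  have hswap : ∀ k : G, (∀ P : Sylow 3 G, k • P = P) → k ≠ 1 →
      ∀ P, k • a P = b P ∧ k • b P = a P := by
    intro k hk hk1
    have hx : ∀ P, k • a P = a P ∨ k • a P = b P ∧ k • b P = a P := by
      intro P
      rcases hmove k P (hk P) _ (ha P) with h | h
      · exact Or.inl h
      · refine Or.inr ⟨h, (hmove k P (hk P) _ (hb P)).resolve_right fun h' => hab P ?_⟩
        exact smul_left_cancel k (h.trans h'.symm)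
    have hsq : k * k = 1 := by
      refine eq_one_of_three_fixed h2 hrange ?_
      rintro _ ⟨P, rfl⟩
      rw [mul_smul]
      rcases hx P with h | ⟨h, h'⟩
      · rw [h, h]
      · rw [h, h']
    intro P
    refine (hx P).resolve_left fun h => hk1 ?_
    have hkP : k ∈ (P : Subgroup G) := ha P ▸ h
    have h3 : k ^ 3 = 1 := by
      have := pow_card_eq_one' (x := (⟨k, hkP⟩ : (P : Subgroup G)))
      rw [show Nat.card (P : Subgroup G) = 3 from hcard P] at this
      exact congrArg Subtype.val this
    rwa [pow_succ, pow_two, hsq, one_mul] at h3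
  have hf : Function.Injective (toPermHom G (Sylow 3 G)) := by
    refine (injective_iff_map_eq_one _).2 fun k hk => ?_
    by_contra hk1
    have hk' : ∀ P : Sylow 3 G, k • P = P := fun P => DFunLike.congr_fun hk P
    -- Two nontrivial kernel elements swap every pair, so their product fixes all `a P`. Hence the
    -- kernel has at most one nontrivial element, equal to all its conjugates.
    have hprod : ∀ l : G, (∀ P : Sylow 3 G, l • P = P) → l ≠ 1 → l * k = 1 := by
      intro l hl hl1
      refine eq_one_of_three_fixed h2 hrange ?_
      rintro _ ⟨P, rfl⟩
      rw [mul_smul, (hswap k hk' hk1 P).1, (hswap l hl hl1 P).2]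
    have hcent : ∀ g : G, g * k = k * g := by
      intro g
      have hl : toPermHom G (Sylow 3 G) (g * k * g⁻¹) = 1 := by
        rw [map_mul, map_mul, hk, mul_one, ← map_mul, mul_inv_cancel, map_one]
      have h1 := hprod (g * k * g⁻¹) (fun P => DFunLike.congr_fun hl P)
        (fun h => hk1 (conj_eq_one_iff.mp h))
      have h3 : g * k * g⁻¹ = k := mul_right_cancel (h1.trans (hprod k hk' hk1).symm)
      exact mul_inv_eq_iff_eq_mul.mp h3
    obtain ⟨x, y, hxy, h⟩ := Set.ncard_eq_two.mp (h2 k hk1)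
    refine hpair ⟨x, y, hxy, fun g => ?_⟩
    have hx : k • x = x := by
      have : x ∈ fixedBy S k := h ▸ Set.mem_insert _ _
      exact this
    have hg : g • x ∈ fixedBy S k := by
      rw [mem_fixedBy, ← mul_smul, ← hcent, mul_smul, hx]
    rw [h] at hg
    exact hg
  have : Finite (Sylow 3 G) := Nat.finite_of_card_ne_zero (by omega)
  have hbij : Function.Bijective (toPermHom G (Sylow 3 G)) := by
    rw [Nat.bijective_iff_injective_and_card]
    exact ⟨hf, by rw [hG, Nat.card_perm, h4]; rfl⟩
  exact ⟨(MulEquiv.ofBijective _ hbij).trans (Finite.equivFinOfCardEq h4).permCongrHom⟩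

theorem card_stabilizer_subgroup_le [Finite G] (H : Subgroup G) (x : S) :
    Nat.card (stabilizer H x) ≤ Nat.card (stabilizer G x) :=
  Nat.card_le_card_of_injective
    (fun h => (⟨h.1.1, h.2⟩ : stabilizer G x)) fun _ _ h =>
      Subtype.ext (Subtype.ext (congrArg (fun k : stabilizer G x => k.1) h))

/-- The conjugation action of the normalizer on the nontrivial elements of a subgroup. -/
abbrev normalizerAction (P : Subgroup G) :
    MulAction (Subgroup.normalizer (P : Set G)) {g : G // g ∈ P ∧ g ≠ 1} where
  smul n g := ⟨n.1 * g.1 * n.1⁻¹, (Subgroup.mem_normalizer_iff.mp n.2 g.1).mp g.2.1,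
    fun h => g.2.2 (conj_eq_one_iff.mp h)⟩
  one_smul g := Subtype.ext (by change 1 * g.1 * 1⁻¹ = g.1; simp)
  mul_smul m n g := Subtype.ext (by
    change (m.1 * n.1) * g.1 * (m.1 * n.1)⁻¹ = m.1 * (n.1 * g.1 * n.1⁻¹) * m.1⁻¹
    group)

/-- A self-centralizing Klein four-group whose involutions are all conjugate
has a normalizer of order twelve. -/
theorem card_normalizer_of_centralizer_eq [Finite G] {P : Subgroup G} (hP : Nat.card P = 4)
    (hcent : ∀ g ∈ P, g ≠ 1 → ∀ k, k * g * k⁻¹ = g ↔ k ∈ P)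
    (hconj : ∀ g ∈ P, g ≠ 1 → ∀ h ∈ P, h ≠ 1 → ∃ k, k * g * k⁻¹ = h) :
    Nat.card (Subgroup.normalizer (P : Set G)) = 12 := by
  let := normalizerAction P
  have hnontriv : Nontrivial P := Finite.one_lt_card_iff_nontrivial.mp (by omega)
  obtain ⟨⟨g, hg⟩, hg1⟩ := exists_ne (1 : P)
  have hg1 : g ≠ 1 := fun h => hg1 (Subtype.ext h)
  let g' : {g : G // g ∈ P ∧ g ≠ 1} := ⟨g, hg, hg1⟩
  have hstab : Nat.card (stabilizer (Subgroup.normalizer (P : Set G)) g') = 4 := by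
    rw [← hP]
    refine Nat.card_congr ⟨fun n => ⟨n.1.1, (hcent g hg hg1 _).mp (congrArg Subtype.val n.2)⟩,
      fun p => ⟨⟨p.1, Subgroup.le_normalizer p.2⟩, Subtype.ext ((hcent g hg hg1 _).mpr p.2)⟩,
      fun n => rfl, fun p => rfl⟩
  -- An element conjugating g to h carries the centralizer of g to that of h. Both are P, so it
  -- normalizes P.
  have horb : orbit (Subgroup.normalizer (P : Set G)) g' = Set.univ := by
    refine Set.eq_univ_of_forall fun h => ?_
    obtain ⟨k, hk⟩ := hconj g hg hg1 h.1 h.2.1 h.2.2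
    have hk' : k ∈ Subgroup.normalizer (P : Set G) := by
      refine Subgroup.mem_normalizer_iff.mpr fun p => ?_
      rw [← hcent g hg hg1, ← hcent h.1 h.2.1 h.2.2, ← hk]
      constructor
      · intro hp
        calc k * p * k⁻¹ * (k * g * k⁻¹) * (k * p * k⁻¹)⁻¹ = k * (p * g * p⁻¹) * k⁻¹ := by group
          _ = k * g * k⁻¹ := by rw [hp]
      · intro hp
        calc p * g * p⁻¹ = k⁻¹ * (k * p * k⁻¹ * (k * g * k⁻¹) * (k * p * k⁻¹)⁻¹) * k := by group
          _ = g := by rw [hp]; group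
    exact ⟨⟨k, hk'⟩, Subtype.ext hk⟩
  have hT : Nat.card {g : G // g ∈ P ∧ g ≠ 1} = 3 := by
    have h1 : {g : G | g ∈ P ∧ g ≠ 1} = (P : Set G) \ {1} := rfl
    have h3 : ((P : Set G) \ {1}).ncard = 3 := by
      rw [Set.ncard_sdiff_singleton_of_mem P.one_mem, ← Nat.card_coe_set_eq]
      change Nat.card P - 1 = 3
      omega
    rw [← h3, ← h1, ← Nat.card_coe_set_eq]
    rfl
  have h := card_orbit_mul_card_stabilizer' (G := Subgroup.normalizer (P : Set G)) g'
  rw [hstab, horb, Nat.card_univ, hT] at h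
  omega

/-- The subgroup is the normalizer of a Sylow 2-subgroup P. The centralizer of a nontrivial g in P
permutes its two fixed points with stabilizers of order at most 2, so it has order at most 4 and
equals P. The elements of order 2 in P are conjugate because their fixed points lie in one orbit.
The normalizer thus has order 12, and a fixed point of an element of order 3 has an orbit of size 4
under it. -/
theorem exists_subgroup_alternatingGroup_of_card_sixty [Finite G]
    (h2 : ∀ g : G, g ≠ 1 → (fixedBy S g).ncard = 2) (hG : Nat.card G = 60)
    (hs : ∀ x : S, 3 ∣ Nat.card (stabilizer G x) → Nat.card (stabilizer G x) = 3) (z : S)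
    (hs2 : ∀ x : S, 2 ∣ Nat.card (stabilizer G x) →
      Nat.card (stabilizer G x) = 2 ∧ x ∈ orbit G z) :
    ∃ H : Subgroup G, Nonempty (H ≃* alternatingGroup (Fin 4)) := by
  have : Fact (Nat.Prime 2) := ⟨Nat.prime_two⟩
  have : Fact (Nat.Prime 3) := ⟨Nat.prime_three⟩
  obtain ⟨P, hP⟩ := Sylow.exists_subgroup_card_pow_prime (G := G) 2 (n := 2) (by rw [hG]; norm_num)
  have hcomm := (IsPGroup.isMulCommutative_of_card_eq_prime_sq hP).is_comm.comm
  have hP4 : Nat.card P = 4 := hP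
  have hfix : ∀ g ∈ P, g ≠ 1 → ∃ x : S, g • x = x ∧ Nat.card (stabilizer G x) = 2 ∧
      x ∈ orbit G z := by
    intro g hg hg1
    obtain ⟨x, y, hxy, h⟩ := Set.ncard_eq_two.mp (h2 g hg1)
    have hx : g • x = x := by
      have : x ∈ fixedBy S g := h ▸ Set.mem_insert _ _
      exact this
    refine ⟨x, hx, hs2 x ?_⟩
    have h1 : orderOf g ∣ 2 ^ 2 := by
      rw [← hP]
      exact Subgroup.orderOf_dvd_natCard P hg
    have h3 : 2 ∣ orderOf g := by
      obtain ⟨k, -, hk⟩ := (Nat.dvd_prime_pow Nat.prime_two).mp h1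
      rw [hk]
      refine dvd_pow_self 2 fun hk0 => hg1 ?_
      rw [hk0, pow_zero, orderOf_eq_one_iff] at hk
      exact hk
    exact h3.trans (Subgroup.orderOf_dvd_natCard _ (show g ∈ stabilizer G x from hx))
  have hcent : ∀ g ∈ P, g ≠ 1 → Subgroup.centralizer {g} = P := by
    intro g hg hg1
    obtain ⟨x, hx, hx2, -⟩ := hfix g hg hg1
    have hle : P ≤ Subgroup.centralizer {g} := fun p hp =>
      Subgroup.mem_centralizer_singleton_iff.mpr
        (congrArg Subtype.val (hcomm ⟨p, hp⟩ ⟨g, hg⟩))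
    refine (Subgroup.eq_of_le_of_card_ge hle ?_).symm
    rw [hP4, ← card_orbit_mul_card_stabilizer' (G := Subgroup.centralizer {g}) x]
    refine (Nat.mul_le_mul (?_ : _ ≤ 2)
      ((card_stabilizer_subgroup_le _ x).trans hx2.le)).trans (le_refl 4)
    rw [← h2 g hg1, Nat.card_coe_set_eq]
    refine Set.ncard_le_ncard ?_ (Set.finite_of_ncard_ne_zero (by rw [h2 g hg1]; norm_num))
    rintro _ ⟨k, rfl⟩
    change g • k.1 • x = k.1 • x
    rw [← mul_smul, ← Subgroup.mem_centralizer_singleton_iff.mp k.2, mul_smul, hx]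
  have hconj : ∀ g ∈ P, g ≠ 1 → ∀ h ∈ P, h ≠ 1 → ∃ k, k * g * k⁻¹ = h := by
    intro g hg hg1 h hh hh1
    obtain ⟨x, hx, -, ⟨a, ha⟩⟩ := hfix g hg hg1
    obtain ⟨y, hy, hy2, ⟨b, hb⟩⟩ := hfix h hh hh1
    have hk : (b * a⁻¹) • x = y := by rw [← ha, ← hb]; simp [mul_smul]
    refine ⟨b * a⁻¹, ?_⟩
    generalize b * a⁻¹ = k at hk
    have h1 : k * g * k⁻¹ ∈ stabilizer G y := by
      rw [mem_stabilizer_iff, ← hk]; simp [mul_smul, hx]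
    obtain ⟨u, v, huv, huniv⟩ := Nat.card_eq_two_iff.mp hy2
    -- A group of order 2 has only one nontrivial element.
    have key : ∀ s t : stabilizer G y, s ≠ 1 → t ≠ 1 → s = t := by
      intro s t hs1 ht1
      have m1 : s ∈ ({u, v} : Set _) := huniv ▸ Set.mem_univ _
      have m2 : t ∈ ({u, v} : Set _) := huniv ▸ Set.mem_univ _
      have m3 : (1 : stabilizer G y) ∈ ({u, v} : Set _) := huniv ▸ Set.mem_univ _
      simp only [Set.mem_insert_iff, Set.mem_singleton_iff] at m1 m2 m3
      grind
    exact congrArg Subtype.val (key ⟨_, h1⟩ ⟨h, hy⟩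
      (fun h' => hg1 (conj_eq_one_iff.mp (congrArg Subtype.val h')))
      (fun h' => hh1 (congrArg Subtype.val h')))
  have hN := card_normalizer_of_centralizer_eq hP4 (fun g hg hg1 k => by
    rw [← hcent g hg hg1, Subgroup.mem_centralizer_singleton_iff, mul_inv_eq_iff_eq_mul]) hconj
  refine ⟨Subgroup.normalizer (P : Set G), ?_⟩
  obtain ⟨c, hc⟩ := exists_prime_orderOf_dvd_card' (G := Subgroup.normalizer (P : Set G)) 3
    (by rw [hN]; norm_num)
  have hc1 : c ≠ 1 := by rintro rfl; simp at hc
  have hN2 := ncard_fixedBy_subgroup h2 (Subgroup.normalizer (P : Set G))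
  obtain ⟨x, y, hxy, h⟩ := Set.ncard_eq_two.mp (hN2 c hc1)
  have hx : c ∈ stabilizer (Subgroup.normalizer (P : Set G)) x := by
    have : x ∈ fixedBy S c := h ▸ Set.mem_insert _ _
    exact this
  have hd : 3 ∣ Nat.card (stabilizer (Subgroup.normalizer (P : Set G)) x) :=
    hc ▸ Subgroup.orderOf_dvd_natCard _ hx
  have hd' : 3 ∣ Nat.card (stabilizer G x) := by
    rw [← hc, ← Subgroup.orderOf_coe]
    exact Subgroup.orderOf_dvd_natCard _ (show c.1 ∈ stabilizer G x from hx)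
  have hle := card_stabilizer_subgroup_le (Subgroup.normalizer (P : Set G)) x
  rw [hs x hd'] at hle
  have h3 := le_antisymm hle (Nat.le_of_dvd Nat.card_pos hd)
  refine nonempty_mulEquiv_alternatingGroup_four (S := S) hN2 hN x ?_
  have := card_orbit_mul_card_stabilizer' (G := Subgroup.normalizer (P : Set G)) x
  rw [h3, hN] at this
  omega

/-! ### The orbit equation and its solutions -/

theorem card_stabilizer_of_mem_orbit [Finite G] {x y : S} (h : y ∈ orbit G x) :
    Nat.card (stabilizer G y) = Nat.card (stabilizer G x) := by
  have h1 := card_orbit_mul_card_stabilizer' (G := G) x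
  rw [← card_orbit_mul_card_stabilizer' (G := G) y, orbit_eq_iff.mpr h] at h1
  have : Finite (orbit G x) := Set.finite_range _
  have : Nonempty (orbit G x) := ⟨⟨x, mem_orbit_self x⟩⟩
  exact (Nat.eq_of_mul_eq_mul_left Nat.card_pos h1).symm

/-- The integer solutions of `1/m₁ + 1/m₂ + 1/m₃ = 1 + 2/N`. -/
theorem orbit_equation {N a b c s t u : ℕ} (h1 : a * s = N) (h2 : b * t = N) (h3 : c * u = N)
    (hs : 2 ≤ s) (hst : s ≤ t) (htu : t ≤ u) (h : a + b + c = N + 2) :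
    c = 2 ∨ s = 2 ∧ t = 3 ∧ (u = 3 ∧ N = 12 ∨ u = 4 ∧ N = 24 ∨ u = 5 ∧ N = 60) := by
  -- If s ≥ 3, the three orbits have total size at most N. After s = 2, the bounds t < 4 and u < 6
  -- come from the same comparison.
  have hs2 : s = 2 := by
    by_contra hne
    have : 3 ≤ s := by omega
    have e1 : a * 3 ≤ N := h1 ▸ Nat.mul_le_mul_left a this
    have e2 : b * 3 ≤ N := h2 ▸ Nat.mul_le_mul_left b (by omega)
    have e3 : c * 3 ≤ N := h3 ▸ Nat.mul_le_mul_left c (by omega)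
    omega
  subst hs2
  have ht : t < 4 := by
    by_contra! ht
    have e2 : b * 4 ≤ N := h2 ▸ Nat.mul_le_mul_left b ht
    have e3 : c * 4 ≤ N := h3 ▸ Nat.mul_le_mul_left c (by omega)
    omega
  interval_cases t
  · left; omega
  · right
    have hu : u < 6 := by
      by_contra! hu
      have e3 : c * 6 ≤ N := h3 ▸ Nat.mul_le_mul_left c hu
      omega
    interval_cases u <;> omega

theorem exists_pair_or_alternatingGroup_of_sorted [Finite G]
    (h2 : ∀ g : G, g ≠ 1 → (fixedBy S g).ncard = 2) {x y z : S}
    (hmem : ∀ w ∈ nonfree G S, w ∈ orbit G x ∨ w ∈ orbit G y ∨ w ∈ orbit G z)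
    (hx : x ∈ nonfree G S)
    (hsum : Nat.card (orbit G x) + Nat.card (orbit G y) + Nat.card (orbit G z) = Nat.card G + 2)
    (hxy : Nat.card (stabilizer G x) ≤ Nat.card (stabilizer G y))
    (hyz : Nat.card (stabilizer G y) ≤ Nat.card (stabilizer G z)) :
    (∃ x y : S, x ≠ y ∧ ∀ g : G, g • x = x ∨ g • x = y) ∨
      ∃ H : Subgroup G, Nonempty (H ≃* alternatingGroup (Fin 4)) := by
  have hs2 : 2 ≤ Nat.card (stabilizer G x) := by
    obtain ⟨g, hg, hgx⟩ := hx
    have : Nontrivial (stabilizer G x) := ⟨⟨g, hgx⟩, 1, fun h => hg (congrArg Subtype.val h)⟩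
    exact Finite.one_lt_card
  have ex := card_orbit_mul_card_stabilizer' (G := G) x
  have ey := card_orbit_mul_card_stabilizer' (G := G) y
  have ez := card_orbit_mul_card_stabilizer' (G := G) z
  by_cases hpair : ∃ x y : S, x ≠ y ∧ ∀ g : G, g • x = x ∨ g • x = y
  · exact Or.inl hpair
  right
  -- The first alternative also records the orbit: in order 60, the points with stabilizer of order
  -- 2 must form a single orbit.
  have hstab : ∀ w : S, Nat.card (stabilizer G w) = 1 ∨
      (Nat.card (stabilizer G w) = Nat.card (stabilizer G x) ∧ w ∈ orbit G x) ∨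
      Nat.card (stabilizer G w) = Nat.card (stabilizer G y) ∨
      Nat.card (stabilizer G w) = Nat.card (stabilizer G z) := by
    intro w
    by_cases hw : w ∈ nonfree G S
    · rcases hmem w hw with h | h | h
      · exact Or.inr (Or.inl ⟨card_stabilizer_of_mem_orbit h, h⟩)
      · exact Or.inr (Or.inr (Or.inl (card_stabilizer_of_mem_orbit h)))
      · exact Or.inr (Or.inr (Or.inr (card_stabilizer_of_mem_orbit h)))
    · left
      have : stabilizer G w = ⊥ := by
        refine (Subgroup.eq_bot_iff_forall _).mpr fun g hg => ?_
        by_contra hg1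
        exact hw ⟨g, hg1, hg⟩
      rw [this, Subgroup.card_bot]
  have hz2 : Nat.card (orbit G z) ≠ 2 := by
    intro hz
    rw [Nat.card_coe_set_eq, Set.ncard_eq_two] at hz
    obtain ⟨p, q, hpq, h⟩ := hz
    have hp : p ∈ orbit G z := h ▸ Set.mem_insert _ _
    refine hpair ⟨p, q, hpq, fun g => ?_⟩
    have : g • p ∈ orbit G z := mem_orbit_of_mem_orbit g hp
    rw [h] at this
    exact this
  obtain hc | ⟨hx2, hy3, hcase⟩ := orbit_equation ex ey ez hs2 hxy hyz hsum
  · exact absurd hc hz2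
  rw [hx2, hy3] at hstab
  have hs3 : Nat.card (stabilizer G z) ≤ 5 → ∀ w : S, 3 ∣ Nat.card (stabilizer G w) →
      Nat.card (stabilizer G w) = 3 := by
    intro hz5 w hw
    rcases hstab w with h | ⟨h, -⟩ | h | h <;> omega
  obtain ⟨hz, hN⟩ | ⟨hz, hN⟩ | ⟨hz, hN⟩ := hcase
  · obtain ⟨e⟩ := nonempty_mulEquiv_alternatingGroup_four h2 hN z (by rw [hz] at ez; omega)
    exact ⟨⊤, ⟨Subgroup.topEquiv.trans e⟩⟩
  · obtain ⟨e⟩ := nonempty_mulEquiv_perm_four h2 hN (hs3 (by omega)) hpair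
    exact ⟨_, ⟨((alternatingGroup (Fin 4)).equivMapOfInjective e.symm.toMonoidHom
      e.symm.injective).symm⟩⟩
  · refine exists_subgroup_alternatingGroup_of_card_sixty h2 hN (hs3 (by omega)) x fun w hw => ?_
    rcases hstab w with h | ⟨h, hw'⟩ | h | h
    · omega
    · exact ⟨h, hw'⟩
    · omega
    · omega

/-- A finite group, all of whose nontrivial elements have exactly two fixed points,
has a fixed point, an invariant pair of points, or a tetrahedral subgroup. -/
theorem exists_pair_or_alternatingGroup [Finite G] [Nontrivial G]
    (h2 : ∀ g : G, g ≠ 1 → (fixedBy S g).ncard = 2) (hfix : ∀ x : S, ∃ g : G, g • x ≠ x) :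
    (∃ x y : S, x ≠ y ∧ ∀ g : G, g • x = x ∨ g • x = y) ∨
      ∃ H : Subgroup G, Nonempty (H ≃* alternatingGroup (Fin 4)) := by
  obtain ⟨x, y, z, hmem, hx, hy, hz, hsum⟩ := exists_three_orbits h2 hfix
  rcases le_total (Nat.card (stabilizer G x)) (Nat.card (stabilizer G y)) with hxy | hxy <;>
  rcases le_total (Nat.card (stabilizer G y)) (Nat.card (stabilizer G z)) with hyz | hyz <;>
  rcases le_total (Nat.card (stabilizer G x)) (Nat.card (stabilizer G z)) with hxz | hxz
  · exact exists_pair_or_alternatingGroup_of_sorted h2 (fun w hw => by grind) hx hsum hxy hyz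
  · exact exists_pair_or_alternatingGroup_of_sorted h2 (fun w hw => by grind) hx hsum hxy hyz
  · exact exists_pair_or_alternatingGroup_of_sorted h2 (x := x) (y := z) (z := y)
      (fun w hw => by grind) hx (by omega) hxz hyz
  · exact exists_pair_or_alternatingGroup_of_sorted h2 (x := z) (y := x) (z := y)
      (fun w hw => by grind) hz (by omega) hxz hxy
  · exact exists_pair_or_alternatingGroup_of_sorted h2 (x := y) (y := x) (z := z)
      (fun w hw => by grind) hy (by omega) hxy hxz
  · exact exists_pair_or_alternatingGroup_of_sorted h2 (x := y) (y := z) (z := x)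
      (fun w hw => by grind) hy (by omega) hyz hxz
  · exact exists_pair_or_alternatingGroup_of_sorted h2 (x := z) (y := y) (z := x)
      (fun w hw => by grind) hz (by omega) hyz hxy
  · exact exists_pair_or_alternatingGroup_of_sorted h2 (x := z) (y := y) (z := x)
      (fun w hw => by grind) hz (by omega) hyz hxy

end TwoFixedPoints

/-! ### Fixed points of Möbius transformations -/

open OnePoint

theorem moebiusGroup_ext {f g : moebiusGroup} (hinf : f • (∞ : Sphere) = g • (∞ : Sphere))
    (h : ∀ z : ℂ, f • (z : Sphere) = g • (z : Sphere)) : f = g := by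
  refine Subtype.ext (Equiv.ext fun x => ?_)
  induction x using OnePoint.rec with
  | infty => exact hinf
  | coe z => exact h z

theorem exists_eq_moebius (g : moebiusGroup) : ∃ a b c d, ∃ h, g = moebius a b c d h := by
  obtain ⟨_, A, rfl⟩ := g
  have hdet : A 0 0 * A 1 1 - A 0 1 * A 1 0 ≠ 0 := by
    rw [← Matrix.det_fin_two]
    exact A.det_ne_zero
  refine ⟨A 0 0, A 0 1, A 1 0, A 1 1, hdet, Subtype.ext ?_⟩
  refine congrArg (toPermHom (GL (Fin 2) ℂ) Sphere) (Units.ext ?_)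
  exact Matrix.eta_fin_two _

theorem moebius_mul (a b c d a' b' c' d' : ℂ) (h : a * d - b * c ≠ 0) (h' : a' * d' - b' * c' ≠ 0) :
    moebius a b c d h * moebius a' b' c' d' h' =
      moebius (a * a' + b * c') (a * b' + b * d') (c * a' + d * c') (c * b' + d * d')
        (by convert mul_ne_zero h h' using 1; ring) := by
  refine (map_mul (toPermHom (GL (Fin 2) ℂ) Sphere).rangeRestrict _ _).symm.trans ?_
  refine congrArg (toPermHom (GL (Fin 2) ℂ) Sphere).rangeRestrict (Units.ext ?_)
  exact Matrix.mul_fin_two ..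

theorem moebius_eq_of_smul {a b c d a' b' c' d' : ℂ} (h : a * d - b * c ≠ 0)
    (h' : a' * d' - b' * c' ≠ 0) {k : ℂ} (hk : k ≠ 0) (ha : a' = k * a) (hb : b' = k * b)
    (hc : c' = k * c) (hd : d' = k * d) : moebius a b c d h = moebius a' b' c' d' h' := by
  subst ha hb hc hd
  refine moebiusGroup_ext ?_ fun z => ?_
  · rw [moebius_smul_infty, moebius_smul_infty]
    simp only [mul_eq_zero, hk, false_or]
    rw [mul_div_mul_left _ _ hk]
  · rw [moebius_smul_coe, moebius_smul_coe, show k * c * z + k * d = k * (c * z + d) by ring,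
      show k * a * z + k * b = k * (a * z + b) by ring, mul_div_mul_left _ _ hk]
    simp only [mul_eq_zero, hk, false_or]

theorem exists_fixed_point (g : moebiusGroup) : ∃ x : Sphere, g • x = x := by
  obtain ⟨a, b, c, d, h, rfl⟩ := exists_eq_moebius g
  by_cases hc : c = 0
  · exact ⟨∞, by rw [moebius_smul_infty, if_pos hc]⟩
  obtain ⟨s, hs⟩ := IsAlgClosed.exists_eq_mul_self (discrim c (d - a) (-b))
  obtain ⟨z, hz⟩ := exists_quadratic_eq_zero hc ⟨s, hs⟩
  -- A common zero of numerator and denominator would make the determinant vanish.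
  have hne : c * z + d ≠ 0 := by
    intro h0
    have h1 : a * z + b = 0 := by linear_combination z * h0 - hz
    refine h ?_
    have h2 : c * (a * d - b * c) = 0 := by
      linear_combination (a * c) * h0 - c * c * h1
    exact (mul_eq_zero.mp h2).resolve_left hc
  refine ⟨z, ?_⟩
  rw [moebius_smul_coe, if_neg hne]
  congr 1
  rw [div_eq_iff hne]
  linear_combination -hz

theorem exists_smul_infty_eq (x : Sphere) : ∃ h : moebiusGroup, h • (∞ : Sphere) = x := by
  induction x using OnePoint.rec with
  | infty => exact ⟨1, one_smul _ _⟩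
  | coe z => exact ⟨moebius z 1 1 0 (by simp), by rw [moebius_smul_infty]; simp⟩

theorem exists_affine {g : moebiusGroup} (hg : g • (∞ : Sphere) = ∞) :
    ∃ a b : ℂ, a ≠ 0 ∧ ∀ z : ℂ, g • (z : Sphere) = ((a * z + b : ℂ) : Sphere) := by
  obtain ⟨a, b, c, d, h, rfl⟩ := exists_eq_moebius g
  have hc : c = 0 := by
    rw [moebius_smul_infty] at hg
    by_contra hc
    rw [if_neg hc] at hg
    exact OnePoint.coe_ne_infty _ hg
  subst hc
  have hd : d ≠ 0 := by rintro rfl; simp at h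
  have ha : a ≠ 0 := by rintro rfl; simp at h
  refine ⟨a / d, b / d, div_ne_zero ha hd, fun z => ?_⟩
  rw [moebius_smul_coe, if_neg (by simpa using hd)]
  congr 1
  rw [zero_mul, zero_add]
  field_simp

theorem fixedBy_eq_pair_of_infty {g : moebiusGroup} (hg1 : g ≠ 1) (hg : g • (∞ : Sphere) = ∞) :
    ∃ x y : Sphere, fixedBy Sphere g = {x, y} ∧ (IsOfFinOrder g → x ≠ y) := by
  obtain ⟨a, b, ha, h⟩ := exists_affine hg
  by_cases ha1 : a = 1
  · subst ha1
    have hb : b ≠ 0 := by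
      rintro rfl
      refine hg1 (moebiusGroup_ext ?_ fun z => ?_)
      · rw [hg, one_smul]
      · rw [h, one_smul]; simp
    -- A translation fixes only ∞, hence the degenerate pair; its powers move 0 to kb ≠ 0, so its
    -- order is infinite.
    refine ⟨∞, ∞, ?_, fun hfin => ?_⟩
    · ext x
      rw [mem_fixedBy, Set.pair_eq_singleton, Set.mem_singleton_iff]
      induction x using OnePoint.rec with
      | infty => simp [hg]
      | coe z => simp [h, hb]
    · exfalso
      obtain ⟨k, hk, hk1⟩ := isOfFinOrder_iff_pow_eq_one.mp hfin
      have hpow : ∀ k : ℕ, g ^ k • ((0 : ℂ) : Sphere) = ((k * b : ℂ) : Sphere) := by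
        intro k
        induction k with
        | zero => simp
        | succ k ih =>
          rw [pow_succ', mul_smul, ih, h]
          push_cast
          congr 1
          ring
      have h0 := hpow k
      rw [hk1, one_smul, OnePoint.coe_eq_coe] at h0
      have : (k : ℂ) ≠ 0 := by exact_mod_cast hk.ne'
      exact mul_ne_zero this hb h0.symm
  · have ha1' : 1 - a ≠ 0 := fun h => ha1 (sub_eq_zero.mp h).symm
    refine ⟨∞, ((b / (1 - a) : ℂ) : Sphere), ?_, fun _ => OnePoint.infty_ne_coe _⟩
    ext x
    rw [mem_fixedBy, Set.mem_insert_iff, Set.mem_singleton_iff]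
    induction x using OnePoint.rec with
    | infty => simp [hg]
    | coe z =>
      rw [h, OnePoint.coe_eq_coe, OnePoint.coe_eq_coe, eq_div_iff ha1']
      simp only [OnePoint.coe_ne_infty, false_or]
      constructor <;> intro h' <;> linear_combination -h'

/-- A nontrivial Moebius transformation has one or two fixed points; two if it has finite order. -/
theorem fixedBy_eq_pair {g : moebiusGroup} (hg1 : g ≠ 1) :
    ∃ x y : Sphere, fixedBy Sphere g = {x, y} ∧ (IsOfFinOrder g → x ≠ y) := by
  obtain ⟨w, hw⟩ := exists_fixed_point g
  obtain ⟨h, hh⟩ := exists_smul_infty_eq w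
  have h1 : (h⁻¹ * g * h) • (∞ : Sphere) = ∞ := by
    rw [mul_smul, mul_smul, hh, hw, ← hh, inv_smul_smul]
  have h3 : g = h * (h⁻¹ * g * h) * h⁻¹ := by group
  obtain ⟨x, y, hxy, hfin⟩ := fixedBy_eq_pair_of_infty (g := h⁻¹ * g * h)
    (fun h0 => hg1 (by rw [h3, h0]; group)) h1
  refine ⟨h • x, h • y, ?_, fun hg hxy' => ?_⟩
  · conv_lhs => rw [h3, ← smul_fixedBy, hxy, Set.smul_set_insert, Set.smul_set_singleton]
  · refine hfin ?_ (smul_left_cancel h hxy')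
    have := (MulAut.conj h⁻¹).toMonoidHom.isOfFinOrder hg
    simpa using this

theorem ncard_fixedBy {g : moebiusGroup} (hg1 : g ≠ 1) (hfin : IsOfFinOrder g) :
    (fixedBy Sphere g).ncard = 2 := by
  obtain ⟨x, y, h, hxy⟩ := fixedBy_eq_pair hg1
  rw [h, Set.ncard_pair (hxy hfin)]

/-- Two elements that agree on α differ by a map fixing at least three points, which is the
identity. So the stabilizer embeds in the self-maps of a finite set. -/
theorem finite_stab {α : Set Sphere} (hα : α.Finite) (hcard : 3 ≤ α.ncard) : Finite (stab α) := by
  have : Finite α := hα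
  have hmem : ∀ (g : stab α) (x : α), g.1 • x.1 ∈ α := fun g x =>
    (mem_stabilizer_set.mp g.2 x.1).mpr x.2
  refine Finite.of_injective (fun (g : stab α) (x : α) => (⟨g.1 • x.1, hmem g x⟩ : α)) ?_
  intro f g hfg
  by_contra hne
  have h1 : g.1⁻¹ * f.1 ≠ 1 := fun h => hne (Subtype.ext (inv_mul_eq_one.mp h).symm)
  obtain ⟨x, y, h, -⟩ := fixedBy_eq_pair h1
  have hsub : α ⊆ {x, y} := by
    rw [← h]
    intro z hz
    have : f.1 • z = g.1 • z := congrArg Subtype.val (congrFun hfg ⟨z, hz⟩)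
    rw [mem_fixedBy, mul_smul, this, inv_smul_smul]
  have := Set.ncard_le_ncard hsub
  have := Set.ncard_insert_le x {y}
  have := Set.ncard_singleton y
  omega

/-! ### Scalings, inversion and the dihedral group -/

/-- The maps `z ↦ u z`. -/
noncomputable def scaling : ℂˣ →* moebiusGroup where
  toFun u := moebius u 0 0 1 (by simp)
  map_one' := by
    refine moebiusGroup_ext ?_ fun z => ?_
    · rw [moebius_smul_infty, one_smul]; simp
    · rw [moebius_smul_coe, one_smul]; simp
  map_mul' u v := by rw [moebius_mul]; congr 1 <;> simp

theorem scaling_eq (u : ℂˣ) : scaling u = moebius u 0 0 1 (by simp) := rfl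

theorem scaling_smul_coe (u : ℂˣ) (z : ℂ) : scaling u • (z : Sphere) = ((u * z : ℂ) : Sphere) := by
  rw [scaling_eq, moebius_smul_coe]
  simp

theorem scaling_smul_infty (u : ℂˣ) : scaling u • (∞ : Sphere) = ∞ := by
  rw [scaling_eq, moebius_smul_infty]
  simp

theorem scaling_injective : Function.Injective scaling := fun u v h => by
  have : scaling u • ((1 : ℂ) : Sphere) = scaling v • ((1 : ℂ) : Sphere) := by rw [h]
  rw [scaling_smul_coe, scaling_smul_coe, OnePoint.coe_eq_coe, mul_one, mul_one] at this
  exact Units.ext this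

theorem inversion_smul_infty : inversion • (∞ : Sphere) = ((0 : ℂ) : Sphere) := by
  rw [inversion, moebius_smul_infty]; simp

theorem inversion_smul_zero : inversion • ((0 : ℂ) : Sphere) = ∞ := by
  rw [inversion, moebius_smul_coe]; simp

theorem inversion_smul_coe {z : ℂ} (hz : z ≠ 0) :
    inversion • (z : Sphere) = ((z⁻¹ : ℂ) : Sphere) := by
  rw [inversion, moebius_smul_coe]; simp [hz]

theorem inversion_mul_self : inversion * inversion = 1 := by
  rw [inversion, moebius_mul]
  refine moebiusGroup_ext ?_ fun z => ?_
  · rw [moebius_smul_infty, one_smul]; simp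
  · rw [moebius_smul_coe, one_smul]; simp

/-- The dihedral relation, which yields the normal forms `scaling u` and `scaling u * inversion`.
The two matrices differ by the scalar u⁻¹. -/
theorem inversion_mul_scaling (u : ℂˣ) : inversion * scaling u = scaling u⁻¹ * inversion := by
  rw [scaling_eq, scaling_eq, inversion, moebius_mul, moebius_mul]
  exact moebius_eq_of_smul _ _ (k := (u : ℂ)⁻¹) (by simp) (by simp) (by simp) (by simp) (by simp)

theorem scaling_ne_scaling_mul_inversion (u v : ℂˣ) : scaling u ≠ scaling v * inversion := by
  intro h
  have : scaling u • (∞ : Sphere) = (scaling v * inversion) • (∞ : Sphere) := by rw [h]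
  rw [scaling_smul_infty, mul_smul, inversion_smul_infty, scaling_smul_coe] at this
  exact OnePoint.infty_ne_coe _ this

/-- `e^{2πi/n}` as a unit. -/
noncomputable def zeta (n : ℕ) : ℂˣ := Units.mk0 (turn (1 / n)) (Complex.exp_ne_zero _)

theorem rotation_eq (n : ℕ) : rotation n = scaling (zeta n) := rfl

theorem isPrimitiveRoot_zeta {n : ℕ} (hn : n ≠ 0) : IsPrimitiveRoot (zeta n) n := by
  rw [← IsPrimitiveRoot.coe_units_iff]
  convert Complex.isPrimitiveRoot_exp n hn using 1
  change Complex.exp _ = _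
  congr 1
  ring

/-- Replaces the exponential description of A_n, B_n and C_n by equations on n-th powers. -/
theorem exists_turn_iff {n : ℕ} (hn : n ≠ 0) (z : ℂ) : (∃ k : ℤ, z = turn (k / n)) ↔ z ^ n = 1 := by
  have hn' : (n : ℂ) ≠ 0 := by exact_mod_cast hn
  constructor
  · rintro ⟨k, rfl⟩
    rw [turn, ← Complex.exp_nat_mul, Complex.exp_eq_one_iff]
    exact ⟨k, by field_simp⟩
  · intro h
    have := NeZero.mk hn
    obtain ⟨k, -, hk⟩ := (Complex.isPrimitiveRoot_exp n hn).eq_pow_of_pow_eq_one h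
    refine ⟨k, ?_⟩
    rw [← hk, turn, ← Complex.exp_nat_mul]
    congr 1
    push_cast
    ring

theorem exists_odd_turn_iff {n : ℕ} (hn : n ≠ 0) (z : ℂ) :
    (∃ k : ℤ, z = turn ((2 * k + 1) / (2 * n))) ↔ z ^ n = -1 := by
  have hn' : (n : ℂ) ≠ 0 := by exact_mod_cast hn
  have hhalf : turn (1 / (2 * n)) ^ n = -1 := by
    rw [turn, ← Complex.exp_nat_mul, ← Complex.exp_pi_mul_I]
    congr 1
    field_simp
  have hne : turn (1 / (2 * n)) ≠ 0 := Complex.exp_ne_zero _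
  have hiff : z ^ n = -1 ↔ (z / turn (1 / (2 * n))) ^ n = 1 := by
    rw [div_pow, hhalf, div_neg, div_one, neg_eq_iff_eq_neg]
  rw [hiff, ← exists_turn_iff hn]
  refine exists_congr fun k => ?_
  rw [div_eq_iff hne, turn, turn, turn, ← Complex.exp_add]
  rw [show (2 * (k : ℂ) + 1) / (2 * n) * (2 * Real.pi * Complex.I) =
    k / n * (2 * Real.pi * Complex.I) + 1 / (2 * n) * (2 * Real.pi * Complex.I) by
      field_simp]

theorem mem_orbA {n : ℕ} (hn : n ≠ 0) (x : Sphere) :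
    x ∈ orbA n ↔ ∃ u : ℂ, u ^ n = 1 ∧ x = u := by
  constructor
  · rintro ⟨k, rfl⟩
    exact ⟨_, (exists_turn_iff hn _).mp ⟨k, rfl⟩, rfl⟩
  · rintro ⟨u, hu, rfl⟩
    obtain ⟨k, rfl⟩ := (exists_turn_iff hn u).mpr hu
    exact ⟨k, rfl⟩

theorem mem_orbB {n : ℕ} (hn : n ≠ 0) (x : Sphere) :
    x ∈ orbB n ↔ ∃ u : ℂ, u ^ n = -1 ∧ x = u := by
  constructor
  · rintro ⟨k, rfl⟩
    exact ⟨_, (exists_odd_turn_iff hn _).mp ⟨k, rfl⟩, rfl⟩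
  · rintro ⟨u, hu, rfl⟩
    obtain ⟨k, rfl⟩ := (exists_odd_turn_iff hn u).mpr hu
    exact ⟨k, rfl⟩

theorem mem_orbC {n : ℕ} (hn : n ≠ 0) (z : ℂ) (x : Sphere) :
    x ∈ orbC n z ↔ ∃ u : ℂ, u ^ n = 1 ∧
      (x = ((z * u : ℂ) : Sphere) ∨ x = ((z⁻¹ * u : ℂ) : Sphere)) := by
  constructor
  · rintro (⟨k, rfl⟩ | ⟨k, rfl⟩)
    · exact ⟨_, (exists_turn_iff hn _).mp ⟨k, rfl⟩, Or.inl rfl⟩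
    · exact ⟨_, (exists_turn_iff hn _).mp ⟨k, rfl⟩, Or.inr rfl⟩
  · rintro ⟨u, hu, rfl | rfl⟩ <;> obtain ⟨k, rfl⟩ := (exists_turn_iff hn u).mpr hu
    · exact Or.inl ⟨k, rfl⟩
    · exact Or.inr ⟨k, rfl⟩

theorem forall_ne_turn_iff {n : ℕ} (hn : n ≠ 0) (z : ℂ) :
    (∀ l : ℤ, z ≠ turn (l / (2 * n))) ↔ z ^ n ≠ 1 ∧ z ^ n ≠ -1 := by
  have h := exists_turn_iff (n := 2 * n) (by omega) z
  push_cast at h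
  rw [← not_exists, h, mul_comm, pow_mul, sq, mul_self_eq_one_iff]
  tauto

theorem exists_scaling_of_mem_dihedral {n : ℕ} (hn : n ≠ 0) {g : moebiusGroup}
    (hg : g ∈ dihedral n) :
    ∃ u : ℂˣ, u ^ n = 1 ∧ (g = scaling u ∨ g = scaling u * inversion) := by
  induction hg using Subgroup.closure_induction with
  | mem x hx =>
    rcases hx with rfl | rfl
    · exact ⟨zeta n, (isPrimitiveRoot_zeta hn).pow_eq_one, Or.inl rfl⟩
    · exact ⟨1, one_pow _, Or.inr (by simp)⟩
  | one => exact ⟨1, one_pow _, Or.inl (by simp)⟩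
  | mul x y _ _ hx hy =>
    obtain ⟨u, hu, rfl | rfl⟩ := hx <;> obtain ⟨v, hv, rfl | rfl⟩ := hy
    · exact ⟨u * v, by rw [mul_pow, hu, hv, one_mul], Or.inl (map_mul _ _ _).symm⟩
    · exact ⟨u * v, by rw [mul_pow, hu, hv, one_mul], Or.inr (by rw [map_mul, mul_assoc])⟩
    · refine ⟨u * v⁻¹, by rw [mul_pow, hu, inv_pow, hv, inv_one, one_mul], Or.inr ?_⟩
      rw [mul_assoc, inversion_mul_scaling, map_mul, mul_assoc]
    · refine ⟨u * v⁻¹, by rw [mul_pow, hu, inv_pow, hv, inv_one, one_mul], Or.inl ?_⟩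
      rw [mul_assoc, ← mul_assoc inversion, inversion_mul_scaling, mul_assoc, inversion_mul_self,
        map_mul, mul_one]
  | inv x _ hx =>
    obtain ⟨u, hu, rfl | rfl⟩ := hx
    · exact ⟨u⁻¹, by rw [inv_pow, hu, inv_one], Or.inl (map_inv _ _).symm⟩
    · refine ⟨u, hu, Or.inr ?_⟩
      rw [inv_eq_iff_mul_eq_one, mul_assoc, ← mul_assoc inversion, inversion_mul_scaling,
        mul_assoc, inversion_mul_self, mul_one, ← map_mul, mul_inv_cancel, map_one]

theorem scaling_mem_dihedral {n : ℕ} (hn : n ≠ 0) {u : ℂˣ} (hu : u ^ n = 1) :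
    scaling u ∈ dihedral n := by
  have := NeZero.mk hn
  obtain ⟨k, -, hk⟩ := (IsPrimitiveRoot.coe_units_iff.mpr
    (isPrimitiveRoot_zeta hn)).eq_pow_of_pow_eq_one (ξ := (u : ℂ)) (by
      rw [← Units.val_pow_eq_pow_val, hu, Units.val_one])
  have hk' : zeta n ^ k = u := Units.ext (by rw [Units.val_pow_eq_pow_val, hk])
  rw [← hk', map_pow]
  exact Subgroup.pow_mem _ (Subgroup.subset_closure (Set.mem_insert _ _)) k

theorem inversion_mem_dihedral (n : ℕ) : inversion ∈ dihedral n :=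
  Subgroup.subset_closure (Set.mem_insert_of_mem _ rfl)

theorem dihedral_le_iff {n : ℕ} {H : Subgroup moebiusGroup} :
    dihedral n ≤ H ↔ rotation n ∈ H ∧ inversion ∈ H := by
  rw [dihedral, Subgroup.closure_le, Set.insert_subset_iff, Set.singleton_subset_iff]
  rfl

theorem scaling_mem_of_dihedral_iff {n : ℕ} (hn : n ≠ 0) (u : ℂˣ) :
    scaling u ∈ dihedral n ↔ u ^ n = 1 := by
  refine ⟨fun h => ?_, scaling_mem_dihedral hn⟩
  obtain ⟨v, hv, h | h⟩ := exists_scaling_of_mem_dihedral hn h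
  · rwa [scaling_injective h]
  · exact absurd h (scaling_ne_scaling_mul_inversion _ _)

theorem exists_mul_self_eq_scaling {n : ℕ} (hn : n ≠ 0) {g : moebiusGroup}
    (hg : g ∈ dihedral n) : ∃ u : ℂˣ, u ^ n = 1 ∧ (g * g = scaling (u * u) ∨ g * g = 1) := by
  obtain ⟨u, hu, rfl | rfl⟩ := exists_scaling_of_mem_dihedral hn hg
  · exact ⟨u, hu, Or.inl (map_mul _ _ _).symm⟩
  · refine ⟨u, hu, Or.inr ?_⟩
    rw [mul_assoc, ← mul_assoc inversion, inversion_mul_scaling,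
        mul_assoc, inversion_mul_self, mul_one, ← map_mul, mul_inv_cancel, map_one]

/-! ### Unions of orbits as invariant sets -/

theorem dihedral_le_stab_iff {n : ℕ} (hn : n ≠ 0) (s : Set Sphere) :
    dihedral n ≤ stab s ↔ (∀ u : ℂˣ, u ^ n = 1 → ∀ x ∈ s, scaling u • x ∈ s) ∧
      ∀ x ∈ s, inversion • x ∈ s := by
  constructor
  · intro h
    exact ⟨fun u hu x hx => (mem_stabilizer_set.mp (h (scaling_mem_dihedral hn hu)) x).mpr hx,
      fun x hx => (mem_stabilizer_set.mp (h (inversion_mem_dihedral n)) x).mpr hx⟩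
  · rintro ⟨h1, h2⟩
    have hz := (isPrimitiveRoot_zeta hn).pow_eq_one
    refine dihedral_le_iff.mpr ⟨mem_stabilizer_set.mpr fun x => ⟨fun hx => ?_, h1 _ hz x⟩,
      mem_stabilizer_set.mpr fun x => ⟨fun hx => ?_, h2 x⟩⟩
    · have := h1 (zeta n)⁻¹ (by rw [inv_pow, hz, inv_one]) _ hx
      rwa [map_inv, rotation_eq, inv_smul_smul] at this
    · have := h2 _ hx
      rwa [← mul_smul, inversion_mul_self, one_smul] at this

theorem dihedral_le_stab_of_mem {n : ℕ} (hn : n ≠ 0) {s : Set Sphere} (hs : s ∈ dihedralOrbits n) :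
    dihedral n ≤ stab s := by
  have hu' : ∀ u : ℂˣ, u ^ n = 1 → (u : ℂ) ^ n = 1 := fun u hu => by
    rw [← Units.val_pow_eq_pow_val, hu, Units.val_one]
  rw [dihedral_le_stab_iff hn]
  rcases hs with (rfl | rfl | rfl) | ⟨z, hz, hzn, rfl⟩
  · constructor
    · rintro u - x (rfl | rfl)
      · rw [scaling_smul_coe, mul_zero]; exact Or.inl rfl
      · rw [scaling_smul_infty]; exact Or.inr rfl
    · rintro x (rfl | rfl)
      · rw [inversion_smul_zero]; exact Or.inr rfl
      · rw [inversion_smul_infty]; exact Or.inl rfl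
  · simp only [mem_orbA hn]
    constructor
    · rintro u hu _ ⟨v, hv, rfl⟩
      exact ⟨u * v, by rw [mul_pow, hu' u hu, hv, one_mul], scaling_smul_coe _ _⟩
    · rintro _ ⟨v, hv, rfl⟩
      have : v ≠ 0 := by rintro rfl; simp [hn] at hv
      exact ⟨v⁻¹, by rw [inv_pow, hv, inv_one], inversion_smul_coe this⟩
  · simp only [mem_orbB hn]
    constructor
    · rintro u hu _ ⟨v, hv, rfl⟩
      exact ⟨u * v, by rw [mul_pow, hu' u hu, hv, one_mul], scaling_smul_coe _ _⟩
    · rintro _ ⟨v, hv, rfl⟩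
      have : v ≠ 0 := by rintro rfl; simp [hn] at hv
      exact ⟨v⁻¹, by rw [inv_pow, hv]; norm_num, inversion_smul_coe this⟩
  · simp only [mem_orbC hn]
    constructor
    · rintro u hu _ ⟨v, hv, rfl | rfl⟩
      · exact ⟨u * v, by rw [mul_pow, hu' u hu, hv, one_mul], Or.inl (by
          rw [scaling_smul_coe]; congr 1; ring)⟩
      · exact ⟨u * v, by rw [mul_pow, hu' u hu, hv, one_mul], Or.inr (by
          rw [scaling_smul_coe]; congr 1; ring)⟩
    · rintro _ ⟨v, hv, rfl | rfl⟩ <;> have hv0 : v ≠ 0 := by rintro rfl; simp [hn] at hv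
      · exact ⟨v⁻¹, by rw [inv_pow, hv, inv_one], Or.inr (by
          rw [inversion_smul_coe (mul_ne_zero hz hv0), mul_inv])⟩
      · exact ⟨v⁻¹, by rw [inv_pow, hv, inv_one], Or.inl (by
          rw [inversion_smul_coe (mul_ne_zero (inv_ne_zero hz) hv0), mul_inv, inv_inv])⟩

theorem le_stab_sUnion {H : Subgroup moebiusGroup} {T : Set (Set Sphere)}
    (h : ∀ s ∈ T, H ≤ stab s) : H ≤ stab (⋃₀ T) := by
  intro g hg
  refine mem_stabilizer_set.mpr fun x => ?_
  simp only [Set.mem_sUnion]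
  exact exists_congr fun s => and_congr_right fun hs => mem_stabilizer_set.mp (h s hs hg) x

theorem isUnionOf_of_forall_mem {F : Set (Set Sphere)} {α : Set Sphere}
    (h : ∀ x ∈ α, ∃ s ∈ F, x ∈ s ∧ s ⊆ α) : IsUnionOf F α := by
  refine ⟨{s | s ∈ F ∧ s ⊆ α}, fun s hs => hs.1, Set.Subset.antisymm (fun x hx => ?_) ?_⟩
  · obtain ⟨s, hs, hxs, hsα⟩ := h x hx
    exact ⟨s, ⟨hs, hsα⟩, hxs⟩
  · exact Set.sUnion_subset fun s hs => hs.2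

/-- The unions of elements of `O_n` are the sets invariant under the dihedral group. -/
theorem isUnionOf_dihedralOrbits_iff {n : ℕ} (hn : n ≠ 0) (α : Set Sphere) :
    IsUnionOf (dihedralOrbits n) α ↔ dihedral n ≤ stab α := by
  constructor
  · rintro ⟨T, hT, rfl⟩
    exact le_stab_sUnion fun s hs => dihedral_le_stab_of_mem hn (hT hs)
  intro h
  obtain ⟨h1, h2⟩ := (dihedral_le_stab_iff hn α).mp h
  -- Points whose quotient is an n-th root of unity lie in α together; this handles A_n, B_n and
  -- both halves of C_n(z).
  have hmul : ∀ z w : ℂ, z ≠ 0 → (w / z) ^ n = 1 → (z : Sphere) ∈ α → (w : Sphere) ∈ α := by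
    intro z w hz hw hzα
    have hne : w / z ≠ 0 := by intro h0; simp [h0, hn] at hw
    have := h1 (Units.mk0 _ hne) (Units.ext (by simpa using hw)) _ hzα
    rwa [scaling_smul_coe, Units.val_mk0, div_mul_cancel₀ _ hz] at this
  refine isUnionOf_of_forall_mem fun x hx => ?_
  induction x using OnePoint.rec with
  | infty =>
    refine ⟨orbV, Or.inl (Or.inl rfl), Or.inr rfl, ?_⟩
    rintro y (rfl | rfl)
    · rw [← inversion_smul_infty]; exact h2 _ hx
    · exact hx
  | coe z =>
    by_cases hz : z = 0
    · subst hz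
      refine ⟨orbV, Or.inl (Or.inl rfl), Or.inl rfl, ?_⟩
      rintro y (rfl | rfl)
      · exact hx
      · rw [← inversion_smul_zero]; exact h2 _ hx
    by_cases hA : z ^ n = 1
    · refine ⟨orbA n, Or.inl (Or.inr (Or.inl rfl)), (mem_orbA hn _).mpr ⟨z, hA, rfl⟩, ?_⟩
      intro y hy
      obtain ⟨w, hw, rfl⟩ := (mem_orbA hn y).mp hy
      exact hmul z w hz (by rw [div_pow, hw, hA, div_one]) hx
    by_cases hB : z ^ n = -1
    · refine ⟨orbB n, Or.inl (Or.inr (Or.inr rfl)), (mem_orbB hn _).mpr ⟨z, hB, rfl⟩, ?_⟩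
      intro y hy
      obtain ⟨w, hw, rfl⟩ := (mem_orbB hn y).mp hy
      exact hmul z w hz (by rw [div_pow, hw, hB]; norm_num) hx
    refine ⟨orbC n z, Or.inr ⟨z, hz, (forall_ne_turn_iff hn z).mpr ⟨hA, hB⟩, rfl⟩,
      (mem_orbC hn z _).mpr ⟨1, one_pow _, Or.inl (by rw [mul_one])⟩, ?_⟩
    intro y hy
    obtain ⟨w, hw, rfl | rfl⟩ := (mem_orbC hn z y).mp hy
    · exact hmul z _ hz (by rw [mul_div_cancel_left₀ _ hz, hw]) hx
    · have hi := h2 _ hx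
      rw [inversion_smul_coe hz] at hi
      exact hmul _ _ (inv_ne_zero hz) (by rw [mul_div_cancel_left₀ _ (inv_ne_zero hz), hw]) hi

theorem isUnionOf_imageFamily_iff (f : moebiusGroup) (F : Set (Set Sphere)) (α : Set Sphere) :
    IsUnionOf (imageFamily f F) α ↔ IsUnionOf F (f⁻¹ • α) := by
  constructor
  · rintro ⟨T, hT, rfl⟩
    refine ⟨(fun s => f⁻¹ • s) '' T, ?_, ?_⟩
    · rintro _ ⟨s, hs, rfl⟩
      obtain ⟨t, ht, rfl⟩ := hT hs
      simpa using ht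
    · rw [Set.sUnion_eq_biUnion, Set.smul_set_iUnion₂, Set.sUnion_image]
  · rintro ⟨T, hT, h⟩
    refine ⟨(fun s => f • s) '' T, ?_, ?_⟩
    · rintro _ ⟨s, hs, rfl⟩
      exact ⟨s, hT hs, rfl⟩
    · rw [Set.sUnion_image, ← Set.smul_set_iUnion₂, ← Set.sUnion_eq_biUnion, ← h, smul_inv_smul]

theorem mem_stab_inv_smul (f g : moebiusGroup) (α : Set Sphere) :
    g ∈ stab (f⁻¹ • α) ↔ f * g * f⁻¹ ∈ stab α := by
  unfold stab
  rw [mem_stabilizer_iff, mem_stabilizer_iff, mul_smul, mul_smul]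
  exact eq_inv_smul_iff

/-! ### Obstructions when the stabilizer is dihedral -/

/-- Squares commute in the dihedral groups. -/
theorem commute_mul_self_of_mem_dihedral {n : ℕ} (hn : n ≠ 0) {f g : moebiusGroup}
    (hf : f ∈ dihedral n) (hg : g ∈ dihedral n) : f * f * (g * g) = g * g * (f * f) := by
  obtain ⟨u, -, h | h⟩ := exists_mul_self_eq_scaling hn hf <;>
  obtain ⟨v, -, h' | h'⟩ := exists_mul_self_eq_scaling hn hg <;> rw [h, h']
  · rw [← map_mul, mul_comm, map_mul]
  · rw [mul_one, one_mul]
  · rw [mul_one, one_mul]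

theorem isUnionOf_orbits_iff (H : Subgroup moebiusGroup) (α : Set Sphere) :
    IsUnionOf (Set.range fun x : Sphere => orbit H x) α ↔ H ≤ stab α := by
  constructor
  · rintro ⟨T, hT, rfl⟩
    refine le_stab_sUnion fun s hs => ?_
    obtain ⟨x, rfl⟩ := hT hs
    exact fun g hg => smul_orbit (⟨g, hg⟩ : H) x
  · intro h
    refine isUnionOf_of_forall_mem fun x hx => ⟨_, ⟨x, rfl⟩, mem_orbit_self x, ?_⟩
    rintro _ ⟨g, rfl⟩
    exact (mem_stabilizer_set.mp (h g.2) x).mpr hx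

/-- The law a²b² = b²a² passes to subgroups, so a group violating it does not embed in a dihedral
group. -/
theorem not_isOrbitUnionOfType {n : ℕ} (hn : n ≠ 0) {α : Set Sphere} (h : stab α = dihedral n)
    (K : Type) [Group K] (hK : ∃ a b : K, a * a * (b * b) ≠ b * b * (a * a)) :
    ¬ IsOrbitUnionOfType K α := by
  rintro ⟨H, ⟨e⟩, hu⟩
  rw [isUnionOf_orbits_iff, h] at hu
  obtain ⟨a, b, hab⟩ := hK
  refine hab (e.symm.injective ?_)
  simp only [map_mul]
  exact Subtype.ext (commute_mul_self_of_mem_dihedral hn (hu (e.symm a).2) (hu (e.symm b).2))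

theorem exists_squares_not_commute_perm_four : ∃ a b : Equiv.Perm (Fin 4),
    a * a * (b * b) ≠ b * b * (a * a) :=
  -- Two 3-cycles sharing two points; their squares are their inverses and do not commute.
  ⟨Equiv.swap 0 1 * Equiv.swap 1 2, Equiv.swap 1 2 * Equiv.swap 2 3, by decide⟩

theorem exists_squares_not_commute_alternating_four : ∃ a b : alternatingGroup (Fin 4),
    a * a * (b * b) ≠ b * b * (a * a) := by
  refine ⟨⟨Equiv.swap 0 1 * Equiv.swap 1 2, ?_⟩, ⟨Equiv.swap 1 2 * Equiv.swap 2 3, ?_⟩,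
    fun h => absurd (congrArg Subtype.val h) ?_⟩
  · rw [Equiv.Perm.mem_alternatingGroup]; decide
  · rw [Equiv.Perm.mem_alternatingGroup]; decide
  · change Equiv.swap (0 : Fin 4) 1 * Equiv.swap 1 2 * (Equiv.swap 0 1 * Equiv.swap 1 2) *
      (Equiv.swap 1 2 * Equiv.swap 2 3 * (Equiv.swap 1 2 * Equiv.swap 2 3)) ≠
      Equiv.swap 1 2 * Equiv.swap 2 3 * (Equiv.swap 1 2 * Equiv.swap 2 3) *
      (Equiv.swap 0 1 * Equiv.swap 1 2 * (Equiv.swap 0 1 * Equiv.swap 1 2))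
    decide

theorem exists_squares_not_commute_alternating_five : ∃ a b : alternatingGroup (Fin 5),
    a * a * (b * b) ≠ b * b * (a * a) := by
  refine ⟨⟨Equiv.swap 0 1 * Equiv.swap 1 2, ?_⟩, ⟨Equiv.swap 1 2 * Equiv.swap 2 3, ?_⟩,
    fun h => absurd (congrArg Subtype.val h) ?_⟩
  · rw [Equiv.Perm.mem_alternatingGroup]; decide
  · rw [Equiv.Perm.mem_alternatingGroup]; decide
  · change Equiv.swap (0 : Fin 5) 1 * Equiv.swap 1 2 * (Equiv.swap 0 1 * Equiv.swap 1 2) *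
      (Equiv.swap 1 2 * Equiv.swap 2 3 * (Equiv.swap 1 2 * Equiv.swap 2 3)) ≠
      Equiv.swap 1 2 * Equiv.swap 2 3 * (Equiv.swap 1 2 * Equiv.swap 2 3) *
      (Equiv.swap 0 1 * Equiv.swap 1 2 * (Equiv.swap 0 1 * Equiv.swap 1 2))
    decide

/-- No conjugate of a larger dihedral group is contained in the Klein four-group. -/
theorem not_isUnionOf_image_of_stab_eq {α : Set Sphere} (h : stab α = dihedral 2)
    (f : moebiusGroup) {p : ℕ} (hp : 2 ≤ p) :
    ¬ IsUnionOf (imageFamily f (dihedralOrbits (2 * p))) α := by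
  rw [isUnionOf_imageFamily_iff, isUnionOf_dihedralOrbits_iff (by omega), dihedral_le_iff]
  rintro ⟨hr, -⟩
  rw [mem_stab_inv_smul, h] at hr
  obtain ⟨u, hu, hsq⟩ := exists_mul_self_eq_scaling two_ne_zero hr
  rw [← sq u, hu, map_one, or_self] at hsq
  -- Squares in `dihedral 2` are trivial, whereas this rotation has order 2p ≥ 4.
  have h1 : rotation (2 * p) * rotation (2 * p) = 1 := by
    have : f * rotation (2 * p) * f⁻¹ * (f * rotation (2 * p) * f⁻¹) =
      f * (rotation (2 * p) * rotation (2 * p)) * f⁻¹ := by group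
    rw [this] at hsq
    exact conj_eq_one_iff.mp hsq
  rw [rotation_eq, ← map_mul, ← map_one scaling] at h1
  have h2 := scaling_injective h1
  rw [← sq, (isPrimitiveRoot_zeta (by omega)).pow_eq_one_iff_dvd] at h2
  have := Nat.le_of_dvd (by norm_num) h2
  omega

/-! ### Groups with an invariant pair of points -/

theorem exists_eq_scaling {g : moebiusGroup} (hinf : g • (∞ : Sphere) = ∞)
    (h0 : g • ((0 : ℂ) : Sphere) = ((0 : ℂ) : Sphere)) : ∃ u : ℂˣ, g = scaling u := by
  obtain ⟨a, b, ha, h⟩ := exists_affine hinf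
  rw [h, OnePoint.coe_eq_coe, mul_zero, zero_add] at h0
  refine ⟨Units.mk0 a ha, moebiusGroup_ext ?_ fun z => ?_⟩
  · rw [hinf, scaling_smul_infty]
  · rw [h, h0, add_zero, scaling_smul_coe, Units.val_mk0]

/-- A finite group of Moebius transformations that contains a dihedral group `D_n` and preserves
`{0, ∞}` is a dihedral group `D_m` with `n ∣ m`. -/
theorem exists_eq_dihedral {n : ℕ} (hn : n ≠ 0) {G : Subgroup moebiusGroup} [Finite G]
    (hle : dihedral n ≤ G)
    (hG : ∀ g ∈ G, g • (∞ : Sphere) = ∞ ∨ g • (∞ : Sphere) = ((0 : ℂ) : Sphere)) :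
    ∃ m, m ≠ 0 ∧ n ∣ m ∧ G = dihedral m := by
  have hinv : inversion ∈ G := hle (inversion_mem_dihedral n)
  have hfix : ∀ g ∈ G, g • (∞ : Sphere) = ∞ → ∃ u, g = scaling u := by
    intro g hg h
    refine exists_eq_scaling h ?_
    have h1 := hG _ (G.mul_mem hg hinv)
    rw [mul_smul, inversion_smul_infty] at h1
    refine h1.resolve_left fun h' => ?_
    exact OnePoint.coe_ne_infty _ (smul_left_cancel g (h'.trans h.symm))
  have hform : ∀ g ∈ G, ∃ u, g = scaling u ∨ g = scaling u * inversion := by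
    intro g hg
    rcases hG g hg with h | h
    · obtain ⟨u, hu⟩ := hfix g hg h
      exact ⟨u, Or.inl hu⟩
    · obtain ⟨u, hu⟩ := hfix (inversion * g) (G.mul_mem hinv hg) (by
        rw [mul_smul, h, inversion_smul_zero])
      refine ⟨u⁻¹, Or.inr ?_⟩
      rw [← inversion_mul_scaling, ← hu, ← mul_assoc, inversion_mul_self, one_mul]
  let K : Subgroup ℂˣ := G.comap scaling
  have hKfin : Finite K := Finite.of_injective (fun u : K => (⟨scaling u.1, u.2⟩ : G))
    fun u v h => Subtype.ext (scaling_injective (congrArg Subtype.val h))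
  have hm : Nat.card K ≠ 0 := Nat.card_pos.ne'
  have := NeZero.mk hm
  -- A subgroup of ℂˣ of order m lies in the m-th roots of unity, and there are only m of those.
  have hK : K = rootsOfUnity (Nat.card K) ℂ := by
    refine Subgroup.eq_of_le_of_card_ge (fun u hu => ?_) ?_
    · exact congrArg Subtype.val (pow_card_eq_one' (x := (⟨u, hu⟩ : K)))
    · exact (Complex.card_rootsOfUnity (Nat.card K)).le
  have hmem : ∀ u : ℂˣ, scaling u ∈ G ↔ u ^ Nat.card K = 1 := fun u => by
    rw [← mem_rootsOfUnity, ← hK]; rfl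
  refine ⟨Nat.card K, hm, ?_, le_antisymm (fun g hg => ?_) (dihedral_le_iff.mpr ⟨?_, hinv⟩)⟩
  · rw [← (isPrimitiveRoot_zeta hn).pow_eq_one_iff_dvd, ← hmem]
    exact (dihedral_le_iff.mp hle).1
  · obtain ⟨u, rfl | rfl⟩ := hform g hg
    · exact scaling_mem_dihedral hm ((hmem u).mp hg)
    · have hu : scaling u ∈ G := (Subgroup.mul_mem_cancel_right G hinv).mp hg
      exact Subgroup.mul_mem _ (scaling_mem_dihedral hm ((hmem u).mp hu)) (inversion_mem_dihedral _)
  · rw [rotation_eq]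
    exact (hmem _).mpr (isPrimitiveRoot_zeta hm).pow_eq_one

theorem turn_half : turn (1 / ((2 : ℕ) : ℂ)) = -1 := by
  rw [turn, ← Complex.exp_pi_mul_I]
  congr 1
  push_cast
  ring

theorem rotation_two : rotation 2 = moebius (-1) 0 0 1 (by norm_num) := by
  unfold rotation
  congr 1
  exact turn_half

/-- With the next three lemmas: φ and ψ conjugate the Klein four-group into itself. The involutions
-z, 1/z, -1/z have the fixed pairs {0, ∞}, {1, -1}, {i, -i}; φ and ψ carry the first pair to the
second and third. -/
theorem phi_mul_rotation : phi * rotation 2 * phi⁻¹ = inversion := by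
  rw [mul_inv_eq_iff_eq_mul, rotation_two, phi, inversion, moebius_mul, moebius_mul]
  exact moebius_eq_of_smul _ _ (k := -1) (by norm_num) (by norm_num) (by norm_num) (by norm_num)
    (by norm_num)

theorem phi_mul_inversion : phi * inversion * phi⁻¹ = rotation 2 := by
  rw [mul_inv_eq_iff_eq_mul, rotation_two, phi, inversion, moebius_mul, moebius_mul]
  exact moebius_eq_of_smul _ _ (k := 1) (by norm_num) (by norm_num) (by norm_num) (by norm_num)
    (by norm_num)

theorem psi_mul_rotation : psi * rotation 2 * psi⁻¹ = rotation 2 * inversion := by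
  rw [mul_inv_eq_iff_eq_mul, rotation_two, psi, inversion, moebius_mul, moebius_mul, moebius_mul]
  exact moebius_eq_of_smul _ _ (k := Complex.I) Complex.I_ne_zero (by simp) (by simp) (by simp)
    (by simp)

theorem psi_mul_inversion : psi * inversion * psi⁻¹ = inversion := by
  rw [mul_inv_eq_iff_eq_mul, psi, inversion, moebius_mul, moebius_mul]
  exact moebius_eq_of_smul _ _ (k := 1) one_ne_zero (by simp) (by simp) (by simp) (by simp)

/-- If `f` normalizes the Klein four-group and the stabilizer of `α` preserves `f{0, ∞}`, then `α`
is a union of elements of some `f(O_{2p})`. -/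
theorem exists_isUnionOf_imageFamily {α : Set Sphere} [hfin : Finite (stab α)]
    (hle : dihedral 2 ≤ stab α) (hne : stab α ≠ dihedral 2) (f : moebiusGroup)
    (hr : f * rotation 2 * f⁻¹ ∈ dihedral 2) (hi : f * inversion * f⁻¹ ∈ dihedral 2)
    (hpair : ∀ g ∈ stab α, g • f • (∞ : Sphere) = f • (∞ : Sphere) ∨
      g • f • (∞ : Sphere) = f • ((0 : ℂ) : Sphere)) :
    ∃ p, 2 ≤ p ∧ IsUnionOf (imageFamily f (dihedralOrbits (2 * p))) α := by
  have hfin' : Finite (stab (f⁻¹ • α)) := by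
    refine Finite.of_injective
      (fun g : stab (f⁻¹ • α) => (⟨_, (mem_stab_inv_smul f g.1 α).mp g.2⟩ : stab α)) ?_
    intro g h hgh
    exact Subtype.ext (mul_left_cancel (mul_right_cancel (congrArg Subtype.val hgh)))
  obtain ⟨m, hm0, ⟨p, rfl⟩, hm⟩ := exists_eq_dihedral two_ne_zero (G := stab (f⁻¹ • α))
    (dihedral_le_iff.mpr ⟨(mem_stab_inv_smul _ _ _).mpr (hle hr),
      (mem_stab_inv_smul _ _ _).mpr (hle hi)⟩) (fun g hg => by
      rcases hpair _ ((mem_stab_inv_smul _ _ _).mp hg) with h | h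
      · left
        rw [mul_smul, mul_smul, inv_smul_smul] at h
        exact smul_left_cancel f h
      · right
        rw [mul_smul, mul_smul, inv_smul_smul] at h
        exact smul_left_cancel f h)
  refine ⟨p, ?_, ?_⟩
  -- For p = 1 the conjugated stabilizer is the Klein four-group; as f conjugates that group into
  -- itself, `stab α` would be `dihedral 2`, against `hne`.
  · by_contra hp
    obtain rfl : p = 1 := by
      have : p ≠ 0 := fun h => hm0 (by rw [h, mul_zero])
      omega
    refine hne (le_antisymm (fun g hg => ?_) hle)
    have h1 : f⁻¹ * g * f ∈ dihedral 2 := by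
      rw [← mul_one 2, ← hm, mem_stab_inv_smul]
      convert hg using 1
      group
    have h2 : dihedral 2 ≤ (dihedral 2).comap (MulAut.conj f).toMonoidHom :=
      dihedral_le_iff.mpr ⟨hr, hi⟩
    have h3 : f * (f⁻¹ * g * f) * f⁻¹ ∈ dihedral 2 := h2 h1
    convert h3 using 1
    group
  · rw [isUnionOf_imageFamily_iff, isUnionOf_dihedralOrbits_iff hm0, hm]

/-- The pairs of points invariant under a group that contains `D_n`. -/
theorem invariant_pair_cases {n : ℕ} (hn : 2 ≤ n) {G : Subgroup moebiusGroup}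
    (hle : dihedral n ≤ G) {x y : Sphere} (h : ∀ g ∈ G, g • x = x ∨ g • x = y) :
    (∀ g ∈ G, g • (∞ : Sphere) = ∞ ∨ g • (∞ : Sphere) = ((0 : ℂ) : Sphere)) ∨
      n = 2 ∧ ((∀ g ∈ G, g • phi • (∞ : Sphere) = phi • (∞ : Sphere) ∨
        g • phi • (∞ : Sphere) = phi • ((0 : ℂ) : Sphere)) ∨
      ∀ g ∈ G, g • psi • (∞ : Sphere) = psi • (∞ : Sphere) ∨
        g • psi • (∞ : Sphere) = psi • ((0 : ℂ) : Sphere)) := by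
  obtain ⟨hrot, hinv⟩ := dihedral_le_iff.mp hle
  -- Lets the two points trade places, since the conclusions are stated for the particular points
  -- φ(∞) = 1 and ψ(∞) = -i.
  have hsymm : ∀ k ∈ G, k • x = y → ∀ g ∈ G, g • y = y ∨ g • y = x := by
    rintro k hk rfl g hg
    rw [← mul_smul]
    exact (h _ (G.mul_mem hg hk)).symm
  have hphi : phi • (∞ : Sphere) = ((1 : ℂ) : Sphere) := by
    rw [phi, moebius_smul_infty]; simp
  have hphi0 : phi • ((0 : ℂ) : Sphere) = ((-1 : ℂ) : Sphere) := by
    rw [phi, moebius_smul_coe]; simp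
  have hpsi : psi • (∞ : Sphere) = ((-Complex.I : ℂ) : Sphere) := by
    rw [psi, moebius_smul_infty]; simp
  have hpsi0 : psi • ((0 : ℂ) : Sphere) = ((Complex.I : ℂ) : Sphere) := by
    rw [psi, moebius_smul_coe]; simp
  induction x using OnePoint.rec with
  | infty =>
    have hy := h _ hinv
    rw [inversion_smul_infty] at hy
    obtain rfl := hy.resolve_left (OnePoint.coe_ne_infty _)
    exact Or.inl h
  | coe z =>
    by_cases hz : z = 0
    · subst hz
      have hy := h _ hinv
      rw [inversion_smul_zero] at hy
      obtain rfl := hy.resolve_left (OnePoint.infty_ne_coe _)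
      exact Or.inl (hsymm _ hinv inversion_smul_zero)
    right
    have hprim := isPrimitiveRoot_zeta (n := n) (by omega)
    have hne : zeta n ≠ 1 := hprim.ne_one (by omega)
    have hne' : (zeta n : ℂ) ≠ 1 := fun h => hne (Units.ext h)
    have hy := h _ hrot
    rw [rotation_eq, scaling_smul_coe, OnePoint.coe_eq_coe] at hy
    obtain rfl := hy.resolve_left fun h => hne' (mul_right_cancel₀ hz (h.trans (one_mul z).symm))
    have h2 := h _ (G.mul_mem hrot hrot)
    rw [mul_smul, rotation_eq, scaling_smul_coe, scaling_smul_coe, OnePoint.coe_eq_coe,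
      OnePoint.coe_eq_coe] at h2
    -- The rotation moves z, so y = ζz. Then ζ²z is z or ζz, and the latter would give ζ = 1.
    have hsq : zeta n ^ 2 = 1 := by
      rcases h2 with h2 | h2
      · refine Units.ext (mul_right_cancel₀ hz ?_)
        rw [Units.val_pow_eq_pow_val, Units.val_one]
        linear_combination h2
      · have h3 := mul_left_cancel₀ (Units.ne_zero _) h2
        exact absurd (mul_right_cancel₀ hz (h3.trans (one_mul z).symm)) hne'
    have hn2 : n = 2 := by
      have := Nat.le_of_dvd (by norm_num) (hprim.pow_eq_one_iff_dvd 2 |>.mp hsq)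
      omega
    refine ⟨hn2, ?_⟩
    subst hn2
    have hzeta : (zeta 2 : ℂ) = -1 := turn_half
    have hrz : rotation 2 • (z : Sphere) = ((-z : ℂ) : Sphere) := by
      rw [rotation_eq, scaling_smul_coe, hzeta, neg_one_mul]
    rw [hzeta, neg_one_mul] at h hsymm
    have h3 := h _ hinv
    rw [inversion_smul_coe hz, OnePoint.coe_eq_coe, OnePoint.coe_eq_coe] at h3
    have hs := hsymm _ hrot hrz
    rw [hphi, hphi0, hpsi, hpsi0]
    -- Inversion sends z to z or -z, so z² = 1 or z² = -1.
    rcases h3 with h3 | h3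
    · left
      have h4 : z * z = 1 := by
        nth_rewrite 1 [← h3]
        exact inv_mul_cancel₀ hz
      rcases mul_self_eq_one_iff.mp h4 with rfl | rfl
      · exact h
      · rwa [neg_neg] at hs
    · right
      have h4 : (z * Complex.I) * (z * Complex.I) = 1 := by
        have h5 : -z * z = 1 := by rw [← h3]; exact inv_mul_cancel₀ hz
        linear_combination z * z * Complex.I_mul_I + h5
      rcases mul_self_eq_one_iff.mp h4 with h5 | h5
      · obtain rfl : z = -Complex.I := by linear_combination -Complex.I * h5 + z * Complex.I_mul_I
        rwa [neg_neg] at h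
      · obtain rfl : z = Complex.I := by linear_combination -Complex.I * h5 + z * Complex.I_mul_I
        exact hs

theorem exists_smul_ne {n : ℕ} (hn : 2 ≤ n) {G : Subgroup moebiusGroup} (hle : dihedral n ≤ G)
    (x : Sphere) : ∃ g : G, g • x ≠ x := by
  obtain ⟨hrot, hinv⟩ := dihedral_le_iff.mp hle
  induction x using OnePoint.rec with
  | infty =>
    refine ⟨⟨_, hinv⟩, fun h => OnePoint.coe_ne_infty (0 : ℂ) ?_⟩
    rw [← inversion_smul_infty]
    exact h
  | coe z =>
    by_cases hz : z = 0
    · subst hz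
      refine ⟨⟨_, hinv⟩, fun h => OnePoint.infty_ne_coe (0 : ℂ) ?_⟩
      rw [← inversion_smul_zero]
      exact h
    refine ⟨⟨_, hrot⟩, fun h => ?_⟩
    have h' : rotation n • (z : Sphere) = z := h
    rw [rotation_eq, scaling_smul_coe, OnePoint.coe_eq_coe] at h'
    exact (isPrimitiveRoot_zeta (n := n) (by omega)).ne_one (by omega)
      (Units.ext (mul_right_cancel₀ hz (h'.trans (one_mul z).symm)))

theorem isOrbitUnionOfType_of_subgroup {α : Set Sphere} {K : Type} [Group K]
    (H : Subgroup (stab α)) (e : H ≃* K) : IsOrbitUnionOfType K α :=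
  ⟨H.map (stab α).subtype, ⟨(H.equivMapOfInjective _ (stab α).subtype_injective).symm.trans e⟩,
    (isUnionOf_orbits_iff _ _).mpr (Subgroup.map_subtype_le H)⟩

end MoebiusStab

/-! ### The characterization -/

theorem mainTheorem8 (n : ℕ) (hn : 2 ≤ n) (α : Set MoebiusStab.Sphere) (hfin : α.Finite)
    (hcard : 3 ≤ α.ncard) :
    MoebiusStab.stab α = MoebiusStab.dihedral n ↔
      MoebiusStab.IsUnionOf (MoebiusStab.dihedralOrbits n) α ∧
      (∀ p : ℕ, 2 ≤ p → ¬ MoebiusStab.IsUnionOf (MoebiusStab.dihedralOrbits (p * n)) α) ∧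
      (n = 2 → ∀ p : ℕ, 2 ≤ p → ¬ MoebiusStab.IsUnionOf
        (MoebiusStab.imageFamily MoebiusStab.phi (MoebiusStab.dihedralOrbits (2 * p))) α) ∧
      (n = 2 → ∀ p : ℕ, 2 ≤ p → ¬ MoebiusStab.IsUnionOf
        (MoebiusStab.imageFamily MoebiusStab.psi (MoebiusStab.dihedralOrbits (2 * p))) α) ∧
      (¬ MoebiusStab.IcosahedralCase α ∧ ¬ MoebiusStab.OctahedralCase α ∧
        ¬ MoebiusStab.TetrahedralCase α) := by
  open MoebiusStab in
  have hn0 : n ≠ 0 := by omega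
  rw [isUnionOf_dihedralOrbits_iff hn0]
  constructor
  · intro h
    refine ⟨h.ge, fun p hp hu => ?_, ?_, ?_,
      not_isOrbitUnionOfType hn0 h _ exists_squares_not_commute_alternating_five,
      not_isOrbitUnionOfType hn0 h _ exists_squares_not_commute_perm_four,
      fun ht => not_isOrbitUnionOfType hn0 h _ exists_squares_not_commute_alternating_four ht.1⟩
    · have hpn : p * n ≠ 0 := mul_ne_zero (by omega) hn0
      rw [isUnionOf_dihedralOrbits_iff hpn, h, dihedral_le_iff, rotation_eq,
        scaling_mem_of_dihedral_iff hn0, (isPrimitiveRoot_zeta hpn).pow_eq_one_iff_dvd] at hu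
      have := Nat.le_of_dvd (by omega) hu.1
      nlinarith
    · rintro rfl p hp
      exact not_isUnionOf_image_of_stab_eq h _ hp
    · rintro rfl p hp
      exact not_isUnionOf_image_of_stab_eq h _ hp
  · rintro ⟨hle, h2, h3, h4, hico, hocta, htetra⟩
    by_contra hne
    have : Finite (stab α) := finite_stab hfin hcard
    have hfix := exists_smul_ne hn hle
    have : Nontrivial (stab α) := by
      obtain ⟨g, hg⟩ := hfix OnePoint.infty
      exact ⟨g, 1, fun h => hg (by rw [h, one_smul])⟩
    have hpt : ∀ g : stab α, g ≠ 1 → (MulAction.fixedBy Sphere g).ncard = 2 := fun g hg =>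
      ncard_fixedBy (g := g.1) (fun h => hg (Subtype.ext h))
        ((stab α).subtype.isOfFinOrder (isOfFinOrder_of_finite g))
    rcases exists_pair_or_alternatingGroup hpt hfix with ⟨x, y, -, hxy⟩ | ⟨H, ⟨e⟩⟩
    · rcases invariant_pair_cases hn hle (fun g hg => hxy ⟨g, hg⟩) with h | ⟨rfl, h | h⟩
      · obtain ⟨m, hm0, ⟨p, rfl⟩, hm⟩ := exists_eq_dihedral hn0 hle h
        rw [mul_comm] at hm hm0
        have hp : p ≠ 1 := fun hp => hne (by rw [hm, hp, one_mul])
        have hp0 : p ≠ 0 := fun hp => hm0 (by rw [hp, zero_mul])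
        exact h2 p (by omega) ((isUnionOf_dihedralOrbits_iff hm0 α).mpr hm.ge)
      · obtain ⟨p, hp, hu⟩ := exists_isUnionOf_imageFamily hle hne phi
          (by rw [phi_mul_rotation]; exact inversion_mem_dihedral 2)
          (by rw [phi_mul_inversion]; exact (dihedral_le_iff.mp le_rfl).1) h
        exact h3 rfl p hp hu
      · obtain ⟨p, hp, hu⟩ := exists_isUnionOf_imageFamily hle hne psi
          (by
            rw [psi_mul_rotation]
            exact Subgroup.mul_mem _ (dihedral_le_iff.mp le_rfl).1 (inversion_mem_dihedral 2))
          (by rw [psi_mul_inversion]; exact inversion_mem_dihedral 2) h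
        exact h4 rfl p hp hu
    -- A copy of A₄ in the stabilizer is enough: the tetrahedral case asks in addition only for the
    -- two negations already assumed.
    · exact htetra ⟨isOrbitUnionOfType_of_subgroup H e, hico, hocta⟩
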